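/- Work in the Euclidean plane $\mathbb R^2$. A real algebraic curve is the real zero set of a nonconstant polynomial; its degree is the least degree of a nonzero polynomial with that zero set. An irreducible quadratic curve is the infinite zero set of a real polynomial of degree $2$ that is not a union of two (possibly equal) lines. A frontal is a $C^\infty$ curve $\gamma$ with a $C^\infty$ unit field $\nu$ such that $\langle\dot\gamma,\nu\rangle=0$; it is a front if $(\gamma,\nu)$ can be chosen to be an immersion. A set is a front (respectively, regular as a parametrized curve) if near each of its points it is a finite union of images of fronts (respectively, of regular curves) through that point. For a real algebraic curve $\mathcal C$, let $E(\mathcal C)$ be the set of pairs $(x,n)$ with $x=\gamma(t_0)$, $n=\nu(t_0)$ for some injective frontal arc $(\gamma,\nu)$ with image in $\mathcal C$, satisfying $\langle x,n\rangle\ne0$. Let $\mathcal C^*$ be the set of all $x$ with $(x,n)\in E(\mathcal C)$ for some $n$ (the no-silhouette part). The primitive of $\mathcal C^*$ is the closure of $$\Big\{\,2x-\frac{\|x\|^2}{\langle x,n\rangle}\,n \;:\; (x,n)\in E(\mathcal C)\Big\}.$$ With $\Psi(x)=x/\|x\|^2$, the inversion $\mathcal I(\mathcal C)$ is the closure of $\Psi(\mathcal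 C\setminus\{0\})$. **Theorem 3.7.** Let $\mathcal C$ be a real algebraic curve such that $\mathcal C\setminus\{0\}\subset\overline{\mathcal C^*}$, such that $\mathcal C$ contains no circle through the origin, and such that $\mathcal C$ is not itself a line or a circle. Suppose that the primitive of $\mathcal C^*$ is an irreducible quadratic curve $C$, with equation $$a_{11}x^2+a_{22}y^2+2a_{12}xy+2a_1x+2a_2y+c=0 .$$ 1. $\mathcal C$ has degree $3$ or $4$ and is a front, $\mathcal I(\mathcal C)$ is an irreducible quadratic curve, $\mathcal I(\mathcal C)\setminus\{0\}=\Psi(\mathcal C\setminus\{0\})$, and $\mathcal C$ is the set of real solutions of $$(a_{12}^2-a_{11}a_{22})(x^2+y^2)^2+2(a_{12}a_2-a_1a_{22})(x^2+y^2)x+2(a_1a_{12}-a_2a_{11})(x^2+y^2)y$$ $$+(a_2^2-a_{22}c)x^2+2(a_{12}c-a_1a_2)xy+(a_1^2-a_{11}c)y^2=0 .$$ If $C$ is a parabola, then $\mathcal C$ has degree $3$. 2. If $\mathcal I(\mathcal C)$ is an ellipse, then the origin is an isolated point of $\mathcal C$, and $\mathcal C\setminus\{0\}$ is a regular curve. 3.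 If $\mathcal I(\mathcal C)$ is a hyperbola, then $\mathcal C$ is regular as a parametrized curve, it has a node at the origin whose two tangent directions are the asymptotic directions of $\mathcal I(\mathcal C)$, and it is a regular curve near every other point. 4. If $\mathcal I(\mathcal C)$ is a parabola, then $\mathcal C$ has an ordinary cusp at the origin (near the origin it is diffeomorphic to $\{(t^2,t^3)\}$) whose tangent direction is the direction of the axis of $\mathcal I(\mathcal C)$, and it is a regular curve near every other point. -/

import Mathlib

open scoped ContDiff

noncomputable section

namespace PlaneCurve

/-- The Euclidean plane. -/
abbrev Plane : Type := EuclideanSpace ℝ (Fin 2)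

/-! ### Algebraic curves -/

/-- The real zero set of a polynomial in two variables. -/
def polyZeros (F : MvPolynomial (Fin 2) ℝ) : Set Plane :=
  {x | MvPolynomial.eval (fun i => x i) F = 0}

/-- A real algebraic curve: the real zero set of a nonconstant polynomial. -/
def IsAlgebraicCurve (S : Set Plane) : Prop :=
  ∃ F : MvPolynomial (Fin 2) ℝ, 0 < F.totalDegree ∧ S = polyZeros F

/-- `S` is a real algebraic curve of degree `d` (cubic: `d = 3`, quartic: `d = 4`): `d` is the
least degree of a nonzero polynomial with real zero set `S`. -/
def HasDegree (S : Set Plane) (d : ℕ) : Prop :=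
  IsLeast {n : ℕ | ∃ F : MvPolynomial (Fin 2) ℝ, F ≠ 0 ∧ F.totalDegree = n ∧ S = polyZeros F} d

/-- A straight line. -/
def IsLine (S : Set Plane) : Prop :=
  ∃ a b c : ℝ, (a ≠ 0 ∨ b ≠ 0) ∧ S = {x : Plane | a * x 0 + b * x 1 + c = 0}

/-- Coefficients of
`a₁₁ x² + a₂₂ y² + 2 a₁₂ x y + 2 a₁ x + 2 a₂ y + c`. -/
structure QuadEq where
  a₁₁ : ℝ
  a₂₂ : ℝ
  a₁₂ : ℝ
  a₁ : ℝ
  a₂ : ℝ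
  c : ℝ

/-- The set of points that satisfy the equation. -/
def QuadEq.zeros (q : QuadEq) : Set Plane :=
  {x | q.a₁₁ * x 0 ^ 2 + q.a₂₂ * x 1 ^ 2 + 2 * q.a₁₂ * (x 0 * x 1)
    + 2 * q.a₁ * x 0 + 2 * q.a₂ * x 1 + q.c = 0}

/-- An irreducible quadratic curve: the zero set of a polynomial of degree two, which has
infinitely many points (it is neither empty nor a point) and is not the union of two, possibly
equal, lines. -/
def IsIrreducibleQuadraticCurve (S : Set Plane) : Prop :=
  (∃ q : QuadEq, (q.a₁₁ ≠ 0 ∨ q.a₂₂ ≠ 0 ∨ q.a₁₂ ≠ 0) ∧ S = q.zeros) ∧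
  S.Infinite ∧
  ¬ ∃ l₁ l₂ : Set Plane, IsLine l₁ ∧ IsLine l₂ ∧ S = l₁ ∪ l₂

/-- `u`, `v` is an orthonormal frame. -/
def IsFrame (u v : Plane) : Prop :=
  ‖u‖ = 1 ∧ ‖v‖ = 1 ∧ inner ℝ u v = 0

/-- An ellipse (circles included). -/
def IsEllipse (S : Set Plane) : Prop :=
  ∃ (p u v : Plane) (a b : ℝ), IsFrame u v ∧ 0 < a ∧ 0 < b ∧
    S = {x | (inner ℝ (x - p) u / a) ^ 2 + (inner ℝ (x - p) v / b) ^ 2 = 1}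

/-- A hyperbola whose asymptotes have the directions `d₁` and `d₂`. -/
def IsHyperbolaWithAsymptotes (S : Set Plane) (d₁ d₂ : Plane) : Prop :=
  ∃ (p u v : Plane) (a b : ℝ), IsFrame u v ∧ 0 < a ∧ 0 < b ∧
    S = {x | (inner ℝ (x - p) u / a) ^ 2 - (inner ℝ (x - p) v / b) ^ 2 = 1} ∧
    d₁ = a • u + b • v ∧ d₂ = a • u - b • v

/-- A parabola whose axis has the direction `v`. -/
def IsParabolaWithAxis (S : Set Plane) (v : Plane) : Prop :=
  ∃ (p u : Plane) (k : ℝ), IsFrame u v ∧ k ≠ 0 ∧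
    S = {x | inner ℝ (x - p) v = k * inner ℝ (x - p) u ^ 2}

/-- A parabola. -/
def IsParabola (S : Set Plane) : Prop :=
  ∃ v : Plane, IsParabolaWithAxis S v

/-! ### Frontals and fronts -/

/-- `(γ, ν)` is a smooth Legendrian curve on the open set `I` of parameters. -/
def IsLegendrianOn (γ ν : ℝ → Plane) (I : Set ℝ) : Prop :=
  ContDiffOn ℝ ∞ γ I ∧ ContDiffOn ℝ ∞ ν I ∧
    ∀ t ∈ I, ‖ν t‖ = 1 ∧ inner ℝ (deriv γ t) (ν t) = 0

/-- `γ` is a front on `I`: it has a Legendrian lift that is an immersion. -/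
def IsFrontOn (γ : ℝ → Plane) (I : Set ℝ) : Prop :=
  ∃ ν : ℝ → Plane, IsLegendrianOn γ ν I ∧ ∀ t ∈ I, deriv γ t ≠ 0 ∨ deriv ν t ≠ 0

/-- `γ` is a regular smooth curve on `I`. -/
def IsRegularOn (γ : ℝ → Plane) (I : Set ℝ) : Prop :=
  ContDiffOn ℝ ∞ γ I ∧ ∀ t ∈ I, deriv γ t ≠ 0

/-- Near each of its points, `S` is a finite union of images of open intervals under
parametrized curves through the point that have the property `P`. -/
def IsLocalUnionOf (P : (ℝ → Plane) → Set ℝ → Prop) (S : Set Plane) : Prop :=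
  ∀ x ∈ S, ∃ U : Set Plane, IsOpen U ∧ x ∈ U ∧
    ∃ (r : ℕ) (γ : Fin r → ℝ → Plane) (t ε : Fin r → ℝ),
      (∀ i, 0 < ε i ∧ γ i (t i) = x ∧ P (γ i) (Set.Ioo (t i - ε i) (t i + ε i))) ∧
      (⋃ i, γ i '' Set.Ioo (t i - ε i) (t i + ε i)) = U ∩ S

/-- A front set. -/
def IsFrontSet (S : Set Plane) : Prop :=
  IsLocalUnionOf IsFrontOn S

/-- `S` is regular as a parametrized curve: all its local branches are regular curves. -/
def IsRegularlyParametrized (S : Set Plane) : Prop :=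
  IsLocalUnionOf IsRegularOn S

/-! ### The primitive and the inversion -/

/-- The pairs `(x, n)` of a point `x` of `S` and a unit normal `n` at `x` of a nondegenerate
(injectively parametrized) frontal arc of `S` through `x`. -/
def contactElements (S : Set Plane) : Set (Plane × Plane) :=
  {e | ∃ (γ ν : ℝ → Plane) (t₀ ε : ℝ), 0 < ε ∧
    IsLegendrianOn γ ν (Set.Ioo (t₀ - ε) (t₀ + ε)) ∧
    Set.InjOn γ (Set.Ioo (t₀ - ε) (t₀ + ε)) ∧
    Set.MapsTo γ (Set.Ioo (t₀ - ε) (t₀ + ε)) S ∧ γ t₀ = e.1 ∧ ν t₀ = e.2}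

/-- The part of `S` on which the no-silhouette condition `⟨x, n⟩ ≠ 0` holds. -/
def noSilhouettePart (S : Set Plane) : Set Plane :=
  {x | ∃ n, (x, n) ∈ contactElements S ∧ inner ℝ x n ≠ 0}

/-- The locus of the points `2 x - (‖x‖² / ⟨x, n⟩) n`, taken over the no-silhouette part. -/
def primitiveLocus (S : Set Plane) : Set Plane :=
  {y | ∃ x n, (x, n) ∈ contactElements S ∧ inner ℝ x n ≠ 0 ∧
    y = (2 : ℝ) • x - (‖x‖ ^ 2 / inner ℝ x n) • n}

/-- The image of `S \ {0}` under `x ↦ x / ‖x‖²`. -/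
def puncturedInversion (S : Set Plane) : Set Plane :=
  EuclideanGeometry.inversion (0 : Plane) 1 '' (S \ {0})

/-- The inversion of a curve: the closure of the image of `S \ {0}` under `x ↦ x / ‖x‖²`. -/
def curveInversion (S : Set Plane) : Set Plane :=
  closure (puncturedInversion S)

/-! ### Points of a plane curve -/

/-- `φ` is a diffeomorphism from a neighbourhood of `x` onto a neighbourhood of the origin which
takes `x` to the origin and `S` to `T`. -/
def IsLocalModel (φ : OpenPartialHomeomorph Plane Plane) (S : Set Plane) (x : Plane)
    (T : Set Plane) : Prop :=
  x ∈ φ.source ∧ φ x = 0 ∧ ContDiffOn ℝ ∞ φ φ.source ∧ ContDiffOn ℝ ∞ φ.symm φ.target ∧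
    φ '' (φ.source ∩ S) = φ.target ∩ T

/-- Near `x`, the set `S` is a regular curve. -/
def IsRegularAt (S : Set Plane) (x : Plane) : Prop :=
  ∃ φ : OpenPartialHomeomorph Plane Plane, IsLocalModel φ S x {y | y 1 = 0}

/-- `x` is an isolated point of `S`. -/
def IsIsolatedPointOf (S : Set Plane) (x : Plane) : Prop :=
  ∃ U : Set Plane, IsOpen U ∧ U ∩ S = {x}

/-- `x` is a node of `S` whose two branches have the tangent directions `d₁` and `d₂`. -/
def HasNodeAt (S : Set Plane) (x d₁ d₂ : Plane) : Prop :=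
  d₁ ≠ 0 ∧ d₂ ≠ 0 ∧ ∃ φ : OpenPartialHomeomorph Plane Plane,
    IsLocalModel φ S x {y | y 0 * y 1 = 0} ∧
    (fderiv ℝ φ x d₁) 1 = 0 ∧ (fderiv ℝ φ x d₂) 0 = 0

/-- `x` is an ordinary cusp of `S` with the tangent direction `d`. -/
def HasOrdinaryCuspAt (S : Set Plane) (x d : Plane) : Prop :=
  d ≠ 0 ∧ ∃ φ : OpenPartialHomeomorph Plane Plane,
    IsLocalModel φ S x {y | ∃ t : ℝ, y 0 = t ^ 2 ∧ y 1 = t ^ 3} ∧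
    (fderiv ℝ φ x d) 1 = 0

end PlaneCurve

end

open PlaneCurve

/-!
Let `J` be the quarter turn. The line through the point of the primitive given by `(x, n)` which is
orthogonal to `x` passes through `x`, and it is tangent to the primitive as `x` moves along an arc.
Its pole with respect to the unit circle is the inverse of `x`, and so the inverse of `x` lies on
the dual conic of the primitive. An arc on which the point of the primitive is constant would lie
on a circle through the origin, and then `Γ` would contain that circle.

As the dual conic has a rational parametrization, a polynomial that vanishes on infinitely many
points of its inverse vanishes on all of it, so that `Γ \ {0}` is the inverse of the dual conic.
The parametrization takes the value `0` at the complex parameters of isotropic direction, whence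
`0 ∈ Γ` unless the dual conic is a circle; in this case `Γ` would be a line or a circle.

If a polynomial of degree at most two had the zero set `Γ`, then the dual conic would be, up to the
origin, the zero set of a cubic. Such a set meets almost every line, but some line misses the conic
together with all lines close to it.

The type of the dual conic is the sign of the discriminant of its quadratic form, which is also the
lowest order part of the equation of `Γ` at the origin and decides between an isolated point, a
node and a cusp there.
-/

noncomputable section

namespace PlaneCurve

/-! ### Coordinates -/

theorem norm_sq_eq (x : Plane) : ‖x‖ ^ 2 = x 0 ^ 2 + x 1 ^ 2 := by
  rw [EuclideanSpace.real_norm_sq_eq, Fin.sum_univ_two]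

theorem inner_eq (x y : Plane) : inner ℝ x y = x 0 * y 0 + x 1 * y 1 := by
  simp [PiLp.inner_apply, Fin.sum_univ_two, mul_comm]

theorem plane_ext {x y : Plane} (h0 : x 0 = y 0) (h1 : x 1 = y 1) : x = y := by
  ext i; fin_cases i <;> assumption

theorem sq_add_sq_pos {x : Plane} (h : x ≠ 0) : 0 < x 0 ^ 2 + x 1 ^ 2 := by
  rw [← norm_sq_eq]; positivity

/-- The rotation by a right angle. -/
def quarterTurn : Plane →L[ℝ] Plane :=
  (Matrix.toEuclideanLin !![0, -1; 1, 0]).toContinuousLinearMap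

@[simp]
theorem quarterTurn_zero (w : Plane) : quarterTurn w 0 = -w 1 := by
  simp [quarterTurn, Matrix.toEuclideanLin, Matrix.toLpLin_apply, dotProduct]

@[simp]
theorem quarterTurn_one (w : Plane) : quarterTurn w 1 = w 0 := by
  simp [quarterTurn, Matrix.toEuclideanLin, Matrix.toLpLin_apply, dotProduct]

theorem inner_quarterTurn_self (w : Plane) : inner ℝ w (quarterTurn w) = 0 := by
  rw [inner_eq, quarterTurn_zero, quarterTurn_one]; ring

theorem inner_quarterTurn_comm (v w : Plane) :
    inner ℝ v (quarterTurn w) = -inner ℝ w (quarterTurn v) := by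
  simp only [inner_eq, quarterTurn_zero, quarterTurn_one]
  ring

theorem norm_quarterTurn (w : Plane) : ‖quarterTurn w‖ = ‖w‖ := by
  rw [← sq_eq_sq₀ (norm_nonneg _) (norm_nonneg _), norm_sq_eq, norm_sq_eq, quarterTurn_zero,
    quarterTurn_one]
  ring

theorem norm_sq_smul_eq_of_inner_eq_zero {n w : Plane} (h : inner ℝ w n = 0) :
    ‖n‖ ^ 2 • w = inner ℝ w (quarterTurn n) • quarterTurn n := by
  rw [inner_eq] at h
  apply plane_ext <;>
    simp only [PiLp.smul_apply, smul_eq_mul, norm_sq_eq, inner_eq, quarterTurn_zero,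
      quarterTurn_one]
  · linear_combination n 0 * h
  · linear_combination n 1 * h

theorem exists_eq_smul_quarterTurn {n w : Plane} (hn : n ≠ 0) (h : inner ℝ w n = 0) :
    ∃ t : ℝ, w = t • quarterTurn n :=
  ⟨inner ℝ w (quarterTurn n) / ‖n‖ ^ 2, by
    rw [div_eq_inv_mul, mul_smul, ← norm_sq_smul_eq_of_inner_eq_zero h,
      inv_smul_smul₀ (by positivity)]⟩

/-! ### Lines -/

theorem mem_range_add_smul_iff {p d : Plane} (hd : d ≠ 0) {x : Plane} :
    x ∈ Set.range (fun t : ℝ => p + t • d) ↔ inner ℝ (x - p) (quarterTurn d) = 0 := by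
  constructor
  · rintro ⟨t, rfl⟩
    rw [add_sub_cancel_left, real_inner_smul_left, inner_quarterTurn_self, mul_zero]
  · intro h
    have hJd : quarterTurn d ≠ 0 := by rwa [← norm_ne_zero_iff, norm_quarterTurn, norm_ne_zero_iff]
    obtain ⟨t, ht⟩ := exists_eq_smul_quarterTurn hJd h
    have hJJ : quarterTurn (quarterTurn d) = -d := plane_ext (by simp) (by simp)
    refine ⟨-t, ?_⟩
    change p + -t • d = x
    rw [neg_smul, ← smul_neg, ← hJJ, ← ht, add_sub_cancel]

theorem isLine_setOf_inner_add_eq_zero {n : Plane} (hn : n ≠ 0) (c : ℝ) :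
    IsLine {x : Plane | inner ℝ x n + c = 0} := by
  refine ⟨n 0, n 1, c, ?_, ?_⟩
  · by_contra! h
    exact hn (plane_ext h.1 h.2)
  · simp only [inner_eq, mul_comm]

theorem isLine_range_add_smul (p : Plane) {d : Plane} (hd : d ≠ 0) :
    IsLine (Set.range fun t : ℝ => p + t • d) := by
  have hJd : quarterTurn d ≠ 0 := by rwa [← norm_ne_zero_iff, norm_quarterTurn, norm_ne_zero_iff]
  convert isLine_setOf_inner_add_eq_zero hJd (-inner ℝ p (quarterTurn d)) using 1
  ext x
  rw [mem_range_add_smul_iff hd, inner_sub_left, sub_eq_add_neg]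
  rfl

theorem IsLine.exists_eq_range {l : Set Plane} (hl : IsLine l) :
    ∃ p d : Plane, d ≠ 0 ∧ l = Set.range fun t : ℝ => p + t • d := by
  obtain ⟨a, b, c, hab, rfl⟩ := hl
  have hN : a ^ 2 + b ^ 2 ≠ 0 := by rcases hab with h | h <;> positivity
  have hd : (!₂[-b, a] : Plane) ≠ 0 := by
    intro h
    have hb : -b = 0 := congrArg (· 0) h
    have ha : a = 0 := congrArg (· 1) h
    exact hab.elim (· ha) (· (neg_eq_zero.mp hb))
  refine ⟨!₂[-a * c / (a ^ 2 + b ^ 2), -b * c / (a ^ 2 + b ^ 2)], !₂[-b, a], hd, ?_⟩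
  ext x
  rw [mem_range_add_smul_iff hd, Set.mem_ofPred_eq, inner_eq]
  simp only [PiLp.sub_apply, quarterTurn_zero, quarterTurn_one, Matrix.cons_val_zero,
    Matrix.cons_val_one]
  field_simp
  constructor <;> intro h
  · linear_combination -(a ^ 2 + b ^ 2) * h
  · exact mul_left_cancel₀ hN (by linear_combination -h)

/-! ### Conics -/

namespace QuadEq

/-- The value of the quadratic polynomial at a point. -/
def eval (q : QuadEq) (x : Plane) : ℝ :=
  q.a₁₁ * x 0 ^ 2 + q.a₂₂ * x 1 ^ 2 + 2 * q.a₁₂ * (x 0 * x 1) + 2 * q.a₁ * x 0 + 2 * q.a₂ * x 1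
    + q.c

theorem mem_zeros {q : QuadEq} {x : Plane} : x ∈ q.zeros ↔ q.eval x = 0 := Iff.rfl

section Algebra

variable {A : Type*} [CommRing A] [Algebra ℝ A]

/-- The principal quadratic form of the conic, with values in an arbitrary real algebra: it is
evaluated at real and at complex directions and at directions that depend polynomially on a
parameter. -/
def form (q : QuadEq) (X Y : A) : A :=
  q.a₁₁ • X ^ 2 + (2 * q.a₁₂) • (X * Y) + q.a₂₂ • Y ^ 2

/-- Half of the derivative of the quadratic polynomial at the point `p` in the direction
`(X, Y)`. -/
def polar (q : QuadEq) (p : Plane) (X Y : A) : A :=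
  (q.a₁₁ * p 0 + q.a₁₂ * p 1 + q.a₁) • X + (q.a₁₂ * p 0 + q.a₂₂ * p 1 + q.a₂) • Y

theorem map_form {B : Type*} [CommRing B] [Algebra ℝ B] (q : QuadEq) (f : A →ₐ[ℝ] B) (X Y : A) :
    f (q.form X Y) = q.form (f X) (f Y) := by
  simp only [form, map_add, map_smul, map_mul, map_pow]

theorem map_polar {B : Type*} [CommRing B] [Algebra ℝ B] (q : QuadEq) (p : Plane)
    (f : A →ₐ[ℝ] B) (X Y : A) : f (q.polar p X Y) = q.polar p (f X) (f Y) := by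
  simp only [polar, map_add, map_smul]

end Algebra

theorem eval_add_smul (q : QuadEq) (p d : Plane) (t : ℝ) :
    q.eval (p + t • d) = q.eval p + 2 * t * q.polar p (d 0) (d 1) + t ^ 2 * q.form (d 0) (d 1) := by
  simp only [eval, polar, form, PiLp.add_apply, PiLp.smul_apply, smul_eq_mul]
  ring

/-- The determinant of the symmetric matrix of the conic. -/
def det (q : QuadEq) : ℝ :=
  q.a₁₁ * (q.a₂₂ * q.c - q.a₂ ^ 2) - q.a₁₂ * (q.a₁₂ * q.c - q.a₂ * q.a₁)
    + q.a₁ * (q.a₁₂ * q.a₂ - q.a₂₂ * q.a₁)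

theorem range_subset_zeros_iff {q : QuadEq} {p d : Plane} :
    (Set.range fun t : ℝ => p + t • d) ⊆ q.zeros ↔
      q.eval p = 0 ∧ q.polar p (d 0) (d 1) = 0 ∧ q.form (d 0) (d 1) = 0 := by
  simp only [Set.range_subset_iff, mem_zeros, eval_add_smul]
  constructor
  · intro h
    have h0 := h 0
    have h1 := h 1
    have h2 := h (-1)
    exact ⟨by linarith, by linarith, by linarith⟩
  · rintro ⟨h0, h1, h2⟩ t
    rw [h0, h1, h2]; ring

/-- In the basis formed by the homogeneous coordinates of the point, the direction, and a normal
of the direction, the hypotheses say that a `2 × 2` block of the matrix of the conic vanishes. -/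
theorem det_smul_eq_zero {A : Type*} [CommRing A] [Algebra ℝ A] {q : QuadEq} {p : Plane} {X Y : A}
    (h0 : q.eval p = 0) (h1 : q.polar p X Y = 0) (h2 : q.form X Y = 0) :
    q.det • (X ^ 2 + Y ^ 2) ^ 2 = 0 := by
  have h0' : algebraMap ℝ A (q.eval p) = 0 := by rw [h0, map_zero]
  simp only [eval, polar, form, det, Algebra.smul_def, map_add, map_sub, map_mul, map_pow,
    map_ofNat] at *
  generalize algebraMap ℝ A q.a₁₁ = a₁₁ at *
  generalize algebraMap ℝ A q.a₁₂ = a₁₂ at *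
  generalize algebraMap ℝ A q.a₂₂ = a₂₂ at *
  generalize algebraMap ℝ A q.a₁ = a₁ at *
  generalize algebraMap ℝ A q.a₂ = a₂ at *
  generalize algebraMap ℝ A q.c = c at *
  generalize algebraMap ℝ A (p 0) = p₀ at *
  generalize algebraMap ℝ A (p 1) = p₁ at *
  set m₁₁ := a₁₁ * p₀ ^ 2 + a₂₂ * p₁ ^ 2 + 2 * a₁₂ * (p₀ * p₁) + 2 * a₁ * p₀ + 2 * a₂ * p₁ + c
  set m₁₂ := (a₁₁ * p₀ + a₁₂ * p₁ + a₁) * X + (a₁₂ * p₀ + a₂₂ * p₁ + a₂) * Y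
  set m₁₃ := -(a₁₁ * p₀ + a₁₂ * p₁ + a₁) * Y + (a₁₂ * p₀ + a₂₂ * p₁ + a₂) * X
  set m₂₃ := -a₁₁ * X * Y + a₁₂ * (X ^ 2 - Y ^ 2) + a₂₂ * X * Y
  set m₃₃ := a₁₁ * Y ^ 2 - 2 * a₁₂ * (X * Y) + a₂₂ * X ^ 2
  linear_combination (m₁₁ * m₃₃ - m₁₃ ^ 2) * h2 + (-m₁₂ * m₃₃ + 2 * m₁₃ * m₂₃) * h1
    - m₂₃ ^ 2 * h0'

theorem not_line_subset {q : QuadEq} (h : q.det ≠ 0) {l : Set Plane} (hl : IsLine l) :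
    ¬ l ⊆ q.zeros := by
  obtain ⟨p, d, hd, rfl⟩ := hl.exists_eq_range
  rw [range_subset_zeros_iff]
  rintro ⟨h0, h1, h2⟩
  exact smul_ne_zero h (pow_ne_zero 2 (sq_add_sq_pos hd).ne') (det_smul_eq_zero h0 h1 h2)

theorem exists_mulVec_eq_zero {q : QuadEq} (h : q.det = 0) : ∃ k : Fin 3 → ℝ, k ≠ 0 ∧
    q.a₁₁ * k 0 + q.a₁₂ * k 1 + q.a₁ * k 2 = 0 ∧ q.a₁₂ * k 0 + q.a₂₂ * k 1 + q.a₂ * k 2 = 0 ∧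
    q.a₁ * k 0 + q.a₂ * k 1 + q.c * k 2 = 0 := by
  have hdet : (!![q.a₁₁, q.a₁₂, q.a₁; q.a₁₂, q.a₂₂, q.a₂; q.a₁, q.a₂, q.c] :
      Matrix (Fin 3) (Fin 3) ℝ).det = 0 := by
    rw [← h, det, Matrix.det_fin_three]
    simp only [Matrix.of_apply, Matrix.cons_val]
    ring
  obtain ⟨k, hk, hk0⟩ := Matrix.exists_mulVec_eq_zero_iff.mpr hdet
  refine ⟨k, hk, ?_, ?_, ?_⟩
  · simpa [Matrix.mulVec, dotProduct, Fin.sum_univ_three] using congrFun hk0 0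
  · simpa [Matrix.mulVec, dotProduct, Fin.sum_univ_three] using congrFun hk0 1
  · simpa [Matrix.mulVec, dotProduct, Fin.sum_univ_three] using congrFun hk0 2

/-- A kernel vector of the matrix is a vertex of the conic, at infinity if its last coordinate
vanishes: every line that joins a vertex to a point of the conic lies on the conic. -/
theorem exists_isLine_subset {q : QuadEq} (h : q.det = 0) (hinf : q.zeros.Infinite) :
    ∃ l : Set Plane, IsLine l ∧ l ⊆ q.zeros := by
  obtain ⟨k, hk, h0, h1, h2⟩ := exists_mulVec_eq_zero h
  suffices ∃ p d : Plane, d ≠ 0 ∧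
      q.eval p = 0 ∧ q.polar p (d 0) (d 1) = 0 ∧ q.form (d 0) (d 1) = 0 by
    obtain ⟨p, d, hd, hpd⟩ := this
    exact ⟨_, isLine_range_add_smul p hd, range_subset_zeros_iff.mpr hpd⟩
  by_cases hk2 : k 2 = 0
  · simp only [hk2, mul_zero, add_zero] at h0 h1 h2
    obtain ⟨p, hp⟩ := hinf.nonempty
    refine ⟨p, !₂[k 0, k 1], ?_, hp, ?_, ?_⟩
    · rintro hd
      have hk0 : k 0 = 0 := congrArg (· 0) hd
      have hk1 : k 1 = 0 := congrArg (· 1) hd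
      exact hk (by ext i; fin_cases i <;> assumption)
    · simp only [polar, Matrix.cons_val_zero, Matrix.cons_val_one, smul_eq_mul]
      linear_combination p 0 * h0 + p 1 * h1 + h2
    · simp only [form, Matrix.cons_val_zero, Matrix.cons_val_one, smul_eq_mul]
      linear_combination k 0 * h0 + k 1 * h1
  · set κ : Plane := !₂[k 0 / k 2, k 1 / k 2] with hκ
    have hpolar : ∀ X Y : ℝ, q.polar κ X Y = 0 := by
      intro X Y
      simp only [polar, hκ, Matrix.cons_val_zero, Matrix.cons_val_one, smul_eq_mul]
      field_simp
      linear_combination X * h0 + Y * h1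
    have heval : q.eval κ = 0 := by
      simp only [eval, hκ, Matrix.cons_val_zero, Matrix.cons_val_one]
      field_simp
      linear_combination k 0 * h0 + k 1 * h1 + k 2 * h2
    obtain ⟨p, hp, hpκ⟩ := hinf.exists_notMem_finite (Set.finite_singleton κ)
    refine ⟨κ, p - κ, sub_ne_zero.mpr hpκ, heval, hpolar _ _, ?_⟩
    have := q.eval_add_smul κ (p - κ) 1
    rw [one_smul, add_sub_cancel, heval, hpolar, mem_zeros.mp hp] at this
    linarith

theorem zeros_eq_univ_or_eq_union {q : QuadEq} {l : Set Plane} (hl : IsLine l)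
    (hsub : l ⊆ q.zeros) :
    q.zeros = Set.univ ∨ ∃ l₁ l₂ : Set Plane, IsLine l₁ ∧ IsLine l₂ ∧ q.zeros = l₁ ∪ l₂ := by
  obtain ⟨p, d, hd, rfl⟩ := hl.exists_eq_range
  obtain ⟨h0, h1, h2⟩ := range_subset_zeros_iff.mp hsub
  have hN := (sq_add_sq_pos hd).ne'
  set B := -q.a₁₁ * d 0 * d 1 + q.a₁₂ * (d 0 ^ 2 - d 1 ^ 2) + q.a₂₂ * d 0 * d 1
  set n : Plane := (2 * B) • d + (q.form (-d 1) (d 0)) • quarterTurn d with hn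
  set γ : ℝ := 2 * (d 0 ^ 2 + d 1 ^ 2) * q.polar p (-d 1) (d 0) - inner ℝ p n with hγ
  have hfactor : ∀ x, (d 0 ^ 2 + d 1 ^ 2) ^ 2 * q.eval x =
      inner ℝ (x - p) (quarterTurn d) * (inner ℝ x n + γ) := by
    intro x
    simp only [hγ, hn, eval, polar, form, inner_eq, PiLp.sub_apply, PiLp.add_apply,
      PiLp.smul_apply, smul_eq_mul, quarterTurn_zero, quarterTurn_one, B] at h0 h1 h2 ⊢
    linear_combination (d 0 ^ 2 + d 1 ^ 2) ^ 2 * h0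
      + 2 * (d 0 ^ 2 + d 1 ^ 2) * ((x 0 - p 0) * d 0 + (x 1 - p 1) * d 1) * h1
      + ((x 0 - p 0) * d 0 + (x 1 - p 1) * d 1) ^ 2 * h2
  have hzeros : q.zeros = (Set.range fun t : ℝ => p + t • d) ∪ {x | inner ℝ x n + γ = 0} := by
    ext x
    rw [Set.mem_union, mem_range_add_smul_iff hd, Set.mem_ofPred_eq, ← mul_eq_zero, ← hfactor,
      mul_eq_zero_iff_left (pow_ne_zero 2 hN), mem_zeros]
  by_cases hn0 : n = 0
  · rw [hn0] at hzeros
    by_cases hγ0 : γ = 0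
    · left; rw [hzeros, hγ0]; simp
    · right
      exact ⟨_, _, isLine_range_add_smul p hd, isLine_range_add_smul p hd, by simp [hzeros, hγ0]⟩
  · exact .inr ⟨_, _, isLine_range_add_smul p hd, isLine_setOf_inner_add_eq_zero hn0 γ, hzeros⟩

theorem zeros_ne_univ {q : QuadEq} (h : q.a₁₁ ≠ 0 ∨ q.a₂₂ ≠ 0 ∨ q.a₁₂ ≠ 0) :
    q.zeros ≠ Set.univ := by
  intro hu
  have hval (a b : ℝ) : q.a₁₁ * a ^ 2 + q.a₂₂ * b ^ 2 + 2 * q.a₁₂ * (a * b)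
      + 2 * q.a₁ * a + 2 * q.a₂ * b + q.c = 0 :=
    Set.eq_univ_iff_forall.mp hu !₂[a, b]
  have h00 := hval 0 0
  have h10 := hval 1 0
  have h10' := hval (-1) 0
  have h01 := hval 0 1
  have h01' := hval 0 (-1)
  have h11 := hval 1 1
  norm_num at h00 h10 h10' h01 h01' h11
  rcases h with h | h | h <;> apply h <;> linarith

theorem det_ne_zero {q : QuadEq} (h : IsIrreducibleQuadraticCurve q.zeros) : q.det ≠ 0 := by
  obtain ⟨⟨q', hq', hqq'⟩, hinf, hlines⟩ := h
  intro hdet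
  obtain ⟨l, hl, hsub⟩ := exists_isLine_subset hdet hinf
  rcases zeros_eq_univ_or_eq_union hl hsub with huniv | hunion
  · exact zeros_ne_univ hq' (hqq' ▸ huniv)
  · exact hlines hunion

theorem isIrreducibleQuadraticCurve {q : QuadEq} (h : q.det ≠ 0) (hinf : q.zeros.Infinite) :
    IsIrreducibleQuadraticCurve q.zeros := by
  refine ⟨⟨q, ?_, rfl⟩, hinf, ?_⟩
  · contrapose! h
    simp [det, h.1, h.2.1, h.2.2]
  · rintro ⟨l₁, l₂, h₁, -, heq⟩
    exact not_line_subset h h₁ (heq ▸ Set.subset_union_left)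

/-- The polar reciprocal of a conic in the unit circle. -/
def dual (q : QuadEq) : QuadEq where
  a₁₁ := q.a₂ ^ 2 - q.a₂₂ * q.c
  a₂₂ := q.a₁ ^ 2 - q.a₁₁ * q.c
  a₁₂ := q.a₁₂ * q.c - q.a₁ * q.a₂
  a₁ := q.a₁₂ * q.a₂ - q.a₁ * q.a₂₂
  a₂ := q.a₁ * q.a₁₂ - q.a₂ * q.a₁₁
  c := q.a₁₂ ^ 2 - q.a₁₁ * q.a₂₂

theorem det_dual (q : QuadEq) : q.dual.det = -q.det ^ 2 := by
  simp only [det, dual]; ring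

theorem det_dual_ne_zero {q : QuadEq} (hq : q.det ≠ 0) : q.dual.det ≠ 0 := by
  rw [det_dual]
  exact neg_ne_zero.mpr (pow_ne_zero 2 hq)

/-- The value of the dual conic at `y` is the discriminant of the conic restricted to the polar
line `{z | ⟪z, y⟫ = 1}` of `y`. -/
theorem eval_dual (q : QuadEq) {y z : Plane} (h : inner ℝ z y = 1) :
    q.dual.eval y = q.polar z (-y 1) (y 0) ^ 2 - q.eval z * q.form (-y 1) (y 0) := by
  rw [inner_eq] at h
  simp only [eval, dual, polar, form, smul_eq_mul]
  linear_combination (-(2 * (q.a₁₂ * q.a₂ - q.a₁ * q.a₂₂) * y 0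
    + 2 * (q.a₁ * q.a₁₂ - q.a₂ * q.a₁₁) * y 1
    + (q.a₁₂ ^ 2 - q.a₁₁ * q.a₂₂) * (z 0 * y 0 + z 1 * y 1 + 1))) * h

end QuadEq

/-! ### Inversion -/

theorem inversion_apply (x : Plane) (i : Fin 2) :
    EuclideanGeometry.inversion (0 : Plane) 1 x i = x i / (x 0 ^ 2 + x 1 ^ 2) := by
  rw [← norm_sq_eq]
  simp only [EuclideanGeometry.inversion, dist_zero_right, vsub_eq_sub, sub_zero, vadd_eq_add,
    add_zero, PiLp.smul_apply, smul_eq_mul, div_pow, one_pow]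
  ring

theorem inversion_ne_zero {x : Plane} (h : x ≠ 0) :
    EuclideanGeometry.inversion (0 : Plane) 1 x ≠ 0 :=
  mt (EuclideanGeometry.inversion_eq_center one_ne_zero).mp h

theorem mem_puncturedInversion {S : Set Plane} {x : Plane} :
    x ∈ puncturedInversion S ↔ x ≠ 0 ∧ EuclideanGeometry.inversion (0 : Plane) 1 x ∈ S := by
  constructor
  · rintro ⟨y, ⟨hyS, hy0⟩, rfl⟩
    rw [EuclideanGeometry.inversion_inversion _ one_ne_zero]
    exact ⟨inversion_ne_zero hy0, hyS⟩
  · rintro ⟨hx0, hxS⟩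
    exact ⟨_, ⟨hxS, inversion_ne_zero hx0⟩, EuclideanGeometry.inversion_inversion _ one_ne_zero x⟩

namespace QuadEq

/-- The polynomial whose zero set is the inverse of the conic: `‖x‖⁴` times the value of the
quadratic polynomial at `x / ‖x‖²`. -/
def invEval (q : QuadEq) (x : Plane) : ℝ :=
  q.c * (x 0 ^ 2 + x 1 ^ 2) ^ 2 + 2 * q.a₁ * (x 0 ^ 2 + x 1 ^ 2) * x 0
    + 2 * q.a₂ * (x 0 ^ 2 + x 1 ^ 2) * x 1
    + q.a₁₁ * x 0 ^ 2 + 2 * q.a₁₂ * (x 0 * x 1) + q.a₂₂ * x 1 ^ 2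

/-- The inverse of a conic, together with the origin. -/
def invZeros (q : QuadEq) : Set Plane :=
  {x | q.invEval x = 0}

theorem zero_mem_invZeros (q : QuadEq) : (0 : Plane) ∈ q.invZeros := by
  simp [invZeros, invEval]

theorem eval_inversion (q : QuadEq) {x : Plane} (hx : x ≠ 0) :
    q.eval (EuclideanGeometry.inversion 0 1 x) = q.invEval x / (x 0 ^ 2 + x 1 ^ 2) ^ 2 := by
  have hr := (sq_add_sq_pos hx).ne'
  simp only [eval, invEval, inversion_apply]
  field_simp
  ring

theorem inversion_mem_zeros_iff (q : QuadEq) {x : Plane} (hx : x ≠ 0) :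
    EuclideanGeometry.inversion 0 1 x ∈ q.zeros ↔ x ∈ q.invZeros := by
  rw [mem_zeros, eval_inversion q hx, div_eq_zero_iff,
    or_iff_left (pow_ne_zero 2 (sq_add_sq_pos hx).ne')]
  rfl

theorem puncturedInversion_zeros (q : QuadEq) :
    puncturedInversion q.zeros = q.invZeros \ {0} := by
  ext x
  rw [mem_puncturedInversion, Set.mem_sdiff, Set.mem_singleton_iff, and_comm]
  exact and_congr_left fun hx => q.inversion_mem_zeros_iff hx

theorem puncturedInversion_invZeros (q : QuadEq) :
    puncturedInversion q.invZeros = q.zeros \ {0} := by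
  ext x
  rw [mem_puncturedInversion, Set.mem_sdiff, Set.mem_singleton_iff, and_comm]
  refine and_congr_left fun hx => ?_
  rw [← q.inversion_mem_zeros_iff (inversion_ne_zero hx),
    EuclideanGeometry.inversion_inversion _ one_ne_zero]

end QuadEq

/-! ### Rational curves -/

section Rational

open Polynomial

/-- The points of a plane curve with a rational parametrization `s ↦ (p₀ / N, p₁ / N)`. -/
def ratCurve (p : Fin 2 → ℝ[X]) (N : ℝ[X]) : Set Plane :=
  {x | ∃ s : ℝ, N.eval s ≠ 0 ∧ ∀ i, x i = (p i).eval s / N.eval s}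

theorem inversion_mem_ratCurve {p : Fin 2 → ℝ[X]} {N : ℝ[X]} {x : Plane} (hx : x ≠ 0)
    (h : x ∈ ratCurve p N) :
    EuclideanGeometry.inversion 0 1 x ∈ ratCurve (fun i => p i * N) (p 0 ^ 2 + p 1 ^ 2) := by
  obtain ⟨s, hs, hxs⟩ := h
  have hp (i : Fin 2) : (p i).eval s = x i * N.eval s := by rw [hxs i]; field_simp
  have hr := (sq_add_sq_pos hx).ne'
  have hN : (p 0 ^ 2 + p 1 ^ 2).eval s = N.eval s ^ 2 * (x 0 ^ 2 + x 1 ^ 2) := by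
    rw [eval_add, eval_pow, eval_pow, hp, hp]; ring
  refine ⟨s, hN ▸ mul_ne_zero (pow_ne_zero 2 hs) hr, fun i => ?_⟩
  rw [inversion_apply, hN, eval_mul, hp]
  field_simp

theorem exists_clear_denominators (F : MvPolynomial (Fin 2) ℝ) (p : Fin 2 → ℝ[X]) (N : ℝ[X]) :
    ∃ (k : ℕ) (H : ℝ[X]), ∀ (K : Type) [Field K] [Algebra ℝ K] (s : K), aeval s N ≠ 0 →
      aeval s H = aeval s N ^ k * MvPolynomial.aeval (fun i => aeval s (p i) / aeval s N) F := by
  induction F using MvPolynomial.induction_on with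
  | C a => exact ⟨0, C a, fun K _ _ s _ => by simp⟩
  | add F G hF hG =>
    obtain ⟨k, H, h⟩ := hF
    obtain ⟨l, J, h'⟩ := hG
    refine ⟨k + l, N ^ l * H + N ^ k * J, fun K _ _ s hs => ?_⟩
    rw [map_add, map_add, map_mul, map_mul, h K s hs, h' K s hs, map_pow, map_pow]
    ring
  | mul_X F i hF =>
    obtain ⟨k, H, h⟩ := hF
    refine ⟨k + 1, H * p i, fun K _ _ s hs => ?_⟩
    rw [map_mul, map_mul, h K s hs, MvPolynomial.aeval_X, pow_succ]
    field_simp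

theorem aeval_eq_zero_of_infinite {F : MvPolynomial (Fin 2) ℝ} {p : Fin 2 → ℝ[X]} {N : ℝ[X]}
    (h : (ratCurve p N ∩ polyZeros F).Infinite) (K : Type) [Field K] [Algebra ℝ K] (s : K)
    (hs : aeval s N ≠ 0) : MvPolynomial.aeval (fun i => aeval s (p i) / aeval s N) F = 0 := by
  obtain ⟨k, H, hH⟩ := exists_clear_denominators F p N
  have hroots : {s : ℝ | H.IsRoot s}.Infinite := by
    refine Set.Infinite.of_image
      (fun s => (WithLp.toLp 2 fun i => (p i).eval s / N.eval s : Plane)) (h.mono ?_)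
    rintro x ⟨⟨s, hs, hx⟩, hxF⟩
    refine ⟨s, ?_, by ext i; exact (hx i).symm⟩
    have hHs := hH ℝ s (by rwa [coe_aeval_eq_eval])
    simp only [coe_aeval_eq_eval, ← hx] at hHs
    exact hHs.trans (mul_eq_zero_of_right _ hxF)
  have hHs := hH K s hs
  rw [eq_zero_of_infinite_isRoot H hroots, map_zero] at hHs
  exact (mul_eq_zero.mp hHs.symm).resolve_left (pow_ne_zero k hs)

theorem ratCurve_subset_polyZeros {F : MvPolynomial (Fin 2) ℝ} {p : Fin 2 → ℝ[X]} {N : ℝ[X]}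
    (h : (ratCurve p N ∩ polyZeros F).Infinite) : ratCurve p N ⊆ polyZeros F := by
  rintro x ⟨s, hs, hx⟩
  have hF := aeval_eq_zero_of_infinite h ℝ s (by rwa [coe_aeval_eq_eval])
  simp only [coe_aeval_eq_eval, ← hx] at hF
  exact hF

/-- Every direction in the plane is a multiple of `(2 s, 1 - s²)` for some `s`; unlike in the
parametrization by the slope, no direction is missing. -/
def direction {A : Type*} [CommRing A] (s : A) : Fin 2 → A :=
  ![2 * s, 1 - s ^ 2]

theorem direction_sq_add_sq {A : Type*} [CommRing A] (s : A) :
    direction s 0 ^ 2 + direction s 1 ^ 2 = (1 + s ^ 2) ^ 2 := by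
  simp only [direction, Matrix.cons_val_zero, Matrix.cons_val_one]
  ring

theorem map_direction {A B : Type*} [CommRing A] [CommRing B] (f : A →+* B) (s : A)
    (i : Fin 2) : f (direction s i) = direction (f s) i := by
  fin_cases i <;> simp [direction, map_ofNat f 2]

theorem exists_eq_mul_direction {K : Type*} [Field K] [CharZero K] {w : Fin 2 → K} {ρ : K}
    (hρ : ρ ^ 2 = w 0 ^ 2 + w 1 ^ 2) (h : ρ ≠ 0) :
    ∃ s l : K, l ≠ 0 ∧ ∀ i, w i = l * direction s i := by
  simp only [Fin.forall_fin_two, direction, Matrix.cons_val_zero, Matrix.cons_val_one]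
  by_cases hw : w 0 = 0
  · rw [hw] at hρ
    refine ⟨0, w 1, fun h1 => h ?_, by simp [hw], by ring⟩
    simpa [h1] using hρ
  · have hs : ρ - w 1 ≠ 0 := by
      intro h0
      rw [sub_eq_zero.mp h0] at hρ
      simp [hw] at hρ
    refine ⟨(ρ - w 1) / w 0, w 0 ^ 2 / (2 * (ρ - w 1)), by simp [hw, hs], by field_simp, ?_⟩
    field_simp
    linear_combination hρ

theorem exists_eq_smul_direction {w : Plane} (hw : w ≠ 0) :
    ∃ s l : ℝ, l ≠ 0 ∧ ∀ i, w i = l * direction s i :=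
  exists_eq_mul_direction (Real.sq_sqrt (sq_add_sq_pos hw).le)
    (Real.sqrt_ne_zero'.mpr (sq_add_sq_pos hw))

theorem circle_subset_ratCurve {y : Plane} (hy : y ≠ 0) :
    {x : Plane | ‖x‖ ^ 2 = inner ℝ y x} ⊆
      ratCurve (fun i => (C (y 0) * direction X 0 + C (y 1) * direction X 1) * direction X i)
        ((1 + X ^ 2) ^ 2) := by
  intro x hx
  obtain ⟨e, he, hxe⟩ : ∃ e : Plane, e ≠ 0 ∧ ∀ i, ‖e‖ ^ 2 * x i = inner ℝ y e * e i := by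
    by_cases hx0 : x = 0
    · refine ⟨quarterTurn y, ?_, fun i => ?_⟩
      · rwa [← norm_ne_zero_iff, norm_quarterTurn, norm_ne_zero_iff]
      · rw [inner_quarterTurn_self, hx0]; simp
    · exact ⟨x, hx0, fun i => by rw [hx.out]⟩
  obtain ⟨s, l, hl, hes⟩ := exists_eq_smul_direction he
  have hden : (1 + s ^ 2) ^ 2 ≠ 0 := by positivity
  refine ⟨s, by simpa using hden, fun i => ?_⟩
  have hxi := hxe i
  rw [norm_sq_eq, inner_eq, hes 0, hes 1, hes i] at hxi
  have hdir (j : Fin 2) : (direction X j).eval s = direction s j := by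
    simpa using map_direction (evalRingHom s) X j
  simp only [eval_mul, eval_add, eval_C, eval_pow, eval_one, eval_X, hdir]
  rw [eq_div_iff hden, ← direction_sq_add_sq]
  exact mul_left_cancel₀ (pow_ne_zero 2 hl) (by linear_combination hxi)

theorem circle_subset_polyZeros {F : MvPolynomial (Fin 2) ℝ} {y : Plane} (hy : y ≠ 0)
    (h : ({x : Plane | ‖x‖ ^ 2 = inner ℝ y x} ∩ polyZeros F).Infinite) :
    {x : Plane | ‖x‖ ^ 2 = inner ℝ y x} ⊆ polyZeros F :=
  have hsub := circle_subset_ratCurve hy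
  hsub.trans (ratCurve_subset_polyZeros (h.mono (Set.inter_subset_inter_left _ hsub)))

namespace QuadEq

theorem exists_polar_eq_zero (q : QuadEq) (u : Plane) :
    ∃ e : Plane, e ≠ 0 ∧ q.polar u (e 0) (e 1) = 0 := by
  set g : Plane := !₂[q.a₁₁ * u 0 + q.a₁₂ * u 1 + q.a₁, q.a₁₂ * u 0 + q.a₂₂ * u 1 + q.a₂]
    with hg
  have hpolar (e : Plane) : q.polar u (e 0) (e 1) = inner ℝ g e := by
    simp [polar, inner_eq, hg]
  by_cases hg0 : g = 0
  · obtain ⟨e, he⟩ := exists_ne (0 : Plane)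
    exact ⟨e, he, by rw [hpolar, hg0, inner_zero_left]⟩
  · refine ⟨quarterTurn g, ?_, by rw [hpolar, inner_quarterTurn_self]⟩
    rwa [← norm_ne_zero_iff, norm_quarterTurn, norm_ne_zero_iff]

theorem form_ne_zero {q : QuadEq} (hq : q.det ≠ 0) {u e : Plane} (hu : u ∈ q.zeros) (he : e ≠ 0)
    (h : q.polar u (e 0) (e 1) = 0) : q.form (e 0) (e 1) ≠ 0 := fun hform =>
  smul_ne_zero hq (pow_ne_zero 2 (sq_add_sq_pos he).ne') (det_smul_eq_zero hu h hform)

theorem exists_secant {q : QuadEq} (hq : q.det ≠ 0) {u v : Plane} (hu : u ∈ q.zeros)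
    (hv : v ∈ q.zeros) : ∃ (e : Plane) (t : ℝ), e ≠ 0 ∧ v = u + t • e ∧
      q.form (e 0) (e 1) ≠ 0 ∧ t * q.form (e 0) (e 1) = -2 * q.polar u (e 0) (e 1) := by
  by_cases huv : v = u
  · obtain ⟨e, he, hpolar⟩ := q.exists_polar_eq_zero u
    exact ⟨e, 0, he, by simp [huv], form_ne_zero hq hu he hpolar, by simp [hpolar]⟩
  · have he : v - u ≠ 0 := sub_ne_zero.mpr huv
    have hsecant := q.eval_add_smul u (v - u) 1
    rw [one_smul, add_sub_cancel, mem_zeros.mp hu, mem_zeros.mp hv] at hsecant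
    refine ⟨v - u, 1, he, by simp, fun hform => ?_, by linarith⟩
    exact form_ne_zero hq hu he (by linarith) hform

/-- The denominator of the parametrization of the conic by the lines through one of its points. -/
def paramDen (q : QuadEq) : ℝ[X] :=
  q.form (direction X 0) (direction X 1)

/-- The numerators of the parametrization of the conic by the lines through its point `u`. -/
def paramNum (q : QuadEq) (u : Plane) (i : Fin 2) : ℝ[X] :=
  C (u i) * q.paramDen - 2 * q.polar u (direction X 0) (direction X 1) * direction X i

variable {A : Type*} [CommRing A] [Algebra ℝ A]

theorem aeval_direction (s : A) (i : Fin 2) :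
    aeval s (direction (X : ℝ[X]) i) = direction s i := by
  simpa using map_direction (aeval s : ℝ[X] →ₐ[ℝ] A).toRingHom X i

theorem aeval_paramDen (q : QuadEq) (s : A) :
    aeval s q.paramDen = q.form (direction s 0) (direction s 1) := by
  rw [paramDen, map_form, aeval_direction, aeval_direction]

theorem aeval_paramNum (q : QuadEq) (u : Plane) (i : Fin 2) (s : A) :
    aeval s (q.paramNum u i) = algebraMap ℝ A (u i) * q.form (direction s 0) (direction s 1)
      - 2 * q.polar u (direction s 0) (direction s 1) * direction s i := by
  rw [paramNum, map_sub, map_mul, map_mul, map_mul, aeval_paramDen, map_polar, aeval_C, map_ofNat,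
    aeval_direction, aeval_direction, aeval_direction]

theorem zeros_subset_ratCurve {q : QuadEq} (hq : q.det ≠ 0) {u : Plane} (hu : u ∈ q.zeros) :
    q.zeros ⊆ ratCurve (q.paramNum u) q.paramDen := by
  intro v hv
  obtain ⟨e, t, he, hve, hform, ht⟩ := exists_secant hq hu hv
  obtain ⟨s, l, hl, hes⟩ := exists_eq_smul_direction he
  simp only [form, polar, hes, smul_eq_mul] at hform ht
  have hden : q.form (direction s 0) (direction s 1) ≠ 0 := by
    intro h0
    apply hform
    simp only [form, smul_eq_mul] at h0
    linear_combination l ^ 2 * h0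
  refine ⟨s, ?_, fun i => ?_⟩
  · rwa [← coe_aeval_eq_eval, aeval_paramDen]
  · rw [← coe_aeval_eq_eval, aeval_paramDen, aeval_paramNum, eq_div_iff hden, hve,
      PiLp.add_apply, PiLp.smul_apply, smul_eq_mul, hes, Algebra.algebraMap_self_apply]
    apply mul_left_cancel₀ hl
    simp only [form, polar, smul_eq_mul]
    linear_combination direction s i * ht

theorem puncturedInversion_zeros_subset_ratCurve {q : QuadEq} (hq : q.det ≠ 0) {u : Plane}
    (hu : u ∈ q.zeros) : puncturedInversion q.zeros ⊆
      ratCurve (fun i => q.paramNum u i * q.paramDen)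
        (q.paramNum u 0 ^ 2 + q.paramNum u 1 ^ 2) := by
  rintro _ ⟨v, ⟨hv, hv0⟩, rfl⟩
  exact inversion_mem_ratCurve hv0 (zeros_subset_ratCurve hq hu hv)

theorem puncturedInversion_subset_polyZeros {q : QuadEq} (hq : q.det ≠ 0)
    {F : MvPolynomial (Fin 2) ℝ} (h : (puncturedInversion q.zeros ∩ polyZeros F).Infinite) :
    puncturedInversion q.zeros ⊆ polyZeros F := by
  obtain ⟨_, ⟨u, ⟨hu, -⟩, -⟩, -⟩ := h.nonempty
  have hsub := puncturedInversion_zeros_subset_ratCurve hq hu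
  exact hsub.trans (ratCurve_subset_polyZeros (h.mono (Set.inter_subset_inter_left _ hsub)))

theorem exists_isotropic {q : QuadEq} (h : ¬ (q.a₁₁ = q.a₂₂ ∧ q.a₁₂ = 0)) :
    ∃ e : Fin 2 → ℂ, e 0 ^ 2 + e 1 ^ 2 ≠ 0 ∧ q.form (e 0) (e 1) = 0 := by
  simp only [form, Complex.real_smul]
  push_cast
  by_cases hα : q.a₁₁ = 0
  · exact ⟨![1, 0], by simp, by simp [hα]⟩
  by_contra! hc
  obtain ⟨δ, hδ⟩ : ∃ δ : ℂ, δ ^ 2 = (q.a₁₂ ^ 2 - q.a₁₁ * q.a₂₂ : ℂ) :=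
    IsAlgClosed.exists_pow_nat_eq _ two_pos
  have hroot (δ : ℂ) (hδ : δ ^ 2 = (q.a₁₂ ^ 2 - q.a₁₁ * q.a₂₂ : ℂ)) :
      (-q.a₁₂ + δ : ℂ) ^ 2 + q.a₁₁ ^ 2 = 0 := by
    by_contra hne
    refine hc ![-q.a₁₂ + δ, q.a₁₁] hne ?_
    simp only [Matrix.cons_val_zero, Matrix.cons_val_one]
    linear_combination q.a₁₁ * hδ
  have h1 := hroot δ hδ
  have h2 := hroot (-δ) (by rw [neg_sq, hδ])
  have h3 : (q.a₁₂ : ℂ) * δ = 0 := by linear_combination (h2 - h1) / 4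
  rcases mul_eq_zero.mp h3 with hβ | rfl
  · have h4 : q.a₁₁ * (q.a₁₁ - q.a₂₂) = 0 := by
      rw [hβ] at h1 hδ
      exact_mod_cast (by linear_combination h1 - hδ :
        (q.a₁₁ : ℂ) * (q.a₁₁ - q.a₂₂) = 0)
    have hβ' : q.a₁₂ = 0 := by exact_mod_cast hβ
    exact h ⟨sub_eq_zero.mp ((mul_eq_zero.mp h4).resolve_left hα), hβ'⟩
  · have h5 : q.a₁₂ ^ 2 + q.a₁₁ ^ 2 = 0 := by
      exact_mod_cast (by linear_combination h1 : (q.a₁₂ : ℂ) ^ 2 + q.a₁₁ ^ 2 = 0)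
    exact hα (by nlinarith [sq_nonneg q.a₁₂])

/-- The complex points at infinity of the conic, in the isotropic directions of its principal form,
are mapped to the origin by the inversion, except for the circular points, which the inversion
blows up; only circles have no other points at infinity. -/
theorem zero_mem_polyZeros {q : QuadEq} (hq : q.det ≠ 0) (hcirc : ¬ (q.a₁₁ = q.a₂₂ ∧ q.a₁₂ = 0))
    {F : MvPolynomial (Fin 2) ℝ} (h : (puncturedInversion q.zeros ∩ polyZeros F).Infinite) :
    (0 : Plane) ∈ polyZeros F := by
  obtain ⟨_, ⟨u, ⟨hu, -⟩, -⟩, -⟩ := h.nonempty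
  obtain ⟨e, he, hform⟩ := exists_isotropic hcirc
  obtain ⟨ρ, hρ⟩ : ∃ ρ : ℂ, ρ ^ 2 = e 0 ^ 2 + e 1 ^ 2 := IsAlgClosed.exists_pow_nat_eq _ two_pos
  obtain ⟨s, l, hl, hes⟩ := exists_eq_mul_direction hρ (by rintro rfl; exact he (by simp [← hρ]))
  simp only [hes, form, Complex.real_smul] at he hform
  have hdir : direction s 0 ^ 2 + direction s 1 ^ 2 ≠ 0 := fun h0 =>
    he (by linear_combination l ^ 2 * h0)
  have hform : q.form (direction s 0) (direction s 1) = 0 := by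
    simp only [form, Complex.real_smul]
    exact mul_left_cancel₀ (pow_ne_zero 2 hl) (by linear_combination hform)
  have hpolar : q.polar u (direction s 0) (direction s 1) ≠ 0 := fun h0 =>
    smul_ne_zero hq (pow_ne_zero 2 hdir) (det_smul_eq_zero hu h0 hform)
  have hden : aeval s (q.paramNum u 0 ^ 2 + q.paramNum u 1 ^ 2) ≠ 0 := by
    rw [map_add, map_pow, map_pow, aeval_paramNum, aeval_paramNum, hform]
    have : (4 * q.polar u (direction s 0) (direction s 1) ^ 2
        * (direction s 0 ^ 2 + direction s 1 ^ 2)) ≠ 0 := by simp [hpolar, hdir]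
    convert this using 1
    ring
  have hF := aeval_eq_zero_of_infinite (h.mono (Set.inter_subset_inter_left _
    (puncturedInversion_zeros_subset_ratCurve hq hu))) ℂ s hden
  simp only [map_mul, aeval_paramDen, hform, mul_zero, zero_div] at hF
  have hzero : (fun _ : Fin 2 => (0 : ℂ)) = algebraMap ℝ ℂ ∘ fun _ => 0 := by ext; simp
  rw [hzero, MvPolynomial.aeval_algebraMap_apply, Complex.coe_algebraMap,
    Complex.ofReal_eq_zero] at hF
  exact hF

end QuadEq

end Rational

/-! ### The primitive -/

/-- The point of the primitive that corresponds to the point `x` with the unit normal `n`. -/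
def primitive (x n : Plane) : Plane :=
  (2 : ℝ) • x - (‖x‖ ^ 2 / inner ℝ x n) • n

theorem inner_primitive_self {x n : Plane} (h : inner ℝ x n ≠ 0) :
    inner ℝ (primitive x n) x = ‖x‖ ^ 2 := by
  rw [primitive, inner_sub_left, real_inner_smul_left, real_inner_smul_left,
    real_inner_self_eq_norm_sq, real_inner_comm x n, div_mul_cancel₀ _ h]
  ring

theorem inner_primitive_of_inner_eq_zero {x n v : Plane} (h : inner ℝ v n = 0) :
    inner ℝ (primitive x n) v = 2 * inner ℝ x v := by
  rw [primitive, inner_sub_left, real_inner_smul_left, real_inner_smul_left, real_inner_comm v n, h]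
  ring

theorem QuadEq.hasDerivAt_eval_comp (q : QuadEq) {y : ℝ → Plane} {y' : Plane} {t : ℝ}
    (hy : HasDerivAt y y' t) :
    HasDerivAt (fun s => q.eval (y s)) (2 * q.polar (y t) (y' 0) (y' 1)) t := by
  have hcoord (i : Fin 2) : HasDerivAt (fun s => y s i) (y' i) t :=
    (PiLp.hasFDerivAt_apply (𝕜 := ℝ) 2 (y t) i).comp_hasDerivAt t hy
  refine HasDerivAt.congr_deriv ((((((((hcoord 0).fun_pow 2).const_mul q.a₁₁).fun_add
    (((hcoord 1).fun_pow 2).const_mul q.a₂₂)).fun_add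
    (((hcoord 0).fun_mul (hcoord 1)).const_mul (2 * q.a₁₂))).fun_add
    ((hcoord 0).const_mul (2 * q.a₁))).fun_add ((hcoord 1).const_mul (2 * q.a₂))).add_const q.c) ?_
  simp only [polar, smul_eq_mul]
  push_cast
  ring

/-- `(γ, ν)` is an injective frontal arc of `S`, parametrized by the open set `I`, that satisfies
the no-silhouette condition. -/
structure IsNoSilhouetteArc (S : Set Plane) (γ ν : ℝ → Plane) (I : Set ℝ) : Prop where
  isOpen : IsOpen I
  isLegendrianOn : IsLegendrianOn γ ν I
  injOn : Set.InjOn γ I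
  mapsTo : Set.MapsTo γ I S
  inner_ne_zero : ∀ t ∈ I, inner ℝ (γ t) (ν t) ≠ 0

namespace IsNoSilhouetteArc

variable {S : Set Plane} {γ ν : ℝ → Plane} {I : Set ℝ} {t : ℝ}

theorem mem_contactElements (h : IsNoSilhouetteArc S γ ν I) (ht : t ∈ I) :
    (γ t, ν t) ∈ contactElements S := by
  obtain ⟨ε, hε, hsub⟩ := Metric.isOpen_iff.mp h.isOpen t ht
  rw [Real.ball_eq_Ioo] at hsub
  obtain ⟨hγ, hν, hnormal⟩ := h.isLegendrianOn
  exact ⟨γ, ν, t, ε, hε, ⟨hγ.mono hsub, hν.mono hsub, fun s hs => hnormal s (hsub hs)⟩,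
    h.injOn.mono hsub, h.mapsTo.mono_left hsub, rfl, rfl⟩

theorem mem_noSilhouettePart (h : IsNoSilhouetteArc S γ ν I) (ht : t ∈ I) :
    γ t ∈ noSilhouettePart S :=
  ⟨ν t, h.mem_contactElements ht, h.inner_ne_zero t ht⟩

theorem primitive_mem_primitiveLocus (h : IsNoSilhouetteArc S γ ν I) (ht : t ∈ I) :
    primitive (γ t) (ν t) ∈ primitiveLocus S :=
  ⟨γ t, ν t, h.mem_contactElements ht, h.inner_ne_zero t ht, rfl⟩

theorem ne_zero (h : IsNoSilhouetteArc S γ ν I) (ht : t ∈ I) : γ t ≠ 0 := fun h0 =>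
  h.inner_ne_zero t ht (by rw [h0, inner_zero_left])

theorem primitive_ne_zero (h : IsNoSilhouetteArc S γ ν I) (ht : t ∈ I) :
    primitive (γ t) (ν t) ≠ 0 := by
  intro h0
  have hinner := inner_primitive_self (h.inner_ne_zero t ht)
  rw [h0, inner_zero_left] at hinner
  exact h.ne_zero ht (norm_eq_zero.mp (pow_eq_zero_iff two_ne_zero |>.mp hinner.symm))

theorem differentiableAt (h : IsNoSilhouetteArc S γ ν I) (ht : t ∈ I) :
    DifferentiableAt ℝ γ t :=
  (h.isLegendrianOn.1.contDiffAt (h.isOpen.mem_nhds ht)).differentiableAt (by simp)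

theorem differentiableAt_primitive (h : IsNoSilhouetteArc S γ ν I) (ht : t ∈ I) :
    DifferentiableAt ℝ (fun s => primitive (γ s) (ν s)) t := by
  have hγ := h.differentiableAt ht
  have hν : DifferentiableAt ℝ ν t :=
    (h.isLegendrianOn.2.1.contDiffAt (h.isOpen.mem_nhds ht)).differentiableAt (by simp)
  exact (hγ.const_smul (2 : ℝ)).sub
    (((hγ.norm_sq ℝ).div (hγ.inner ℝ hν) (h.inner_ne_zero t ht)).smul hν)

theorem inner_deriv_primitive (h : IsNoSilhouetteArc S γ ν I) (ht : t ∈ I) :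
    inner ℝ (deriv (fun s => primitive (γ s) (ν s)) t) (γ t) = 0 := by
  have hγ := (h.differentiableAt ht).hasDerivAt
  have hprod := (h.differentiableAt_primitive ht).hasDerivAt.inner ℝ hγ
  have heq : (fun s => inner ℝ (primitive (γ s) (ν s)) (γ s)) =ᶠ[nhds t] fun s => ‖γ s‖ ^ 2 := by
    filter_upwards [h.isOpen.mem_nhds ht] with s hs using
      inner_primitive_self (h.inner_ne_zero s hs)
  have hderiv := hprod.unique (hγ.norm_sq.congr_of_eventuallyEq heq)
  rw [inner_primitive_of_inner_eq_zero (h.isLegendrianOn.2.2 t ht).2] at hderiv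
  linarith

theorem polar_deriv_primitive {q : QuadEq} (h : IsNoSilhouetteArc S γ ν I)
    (hprim : primitiveLocus S ⊆ q.zeros) (ht : t ∈ I) :
    q.polar (primitive (γ t) (ν t)) (deriv (fun s => primitive (γ s) (ν s)) t 0)
      (deriv (fun s => primitive (γ s) (ν s)) t 1) = 0 := by
  have hzero : (fun s => q.eval (primitive (γ s) (ν s))) =ᶠ[nhds t] fun _ => 0 := by
    filter_upwards [h.isOpen.mem_nhds ht] with s hs using hprim (h.primitive_mem_primitiveLocus hs)
  have hderiv := (q.hasDerivAt_eval_comp (h.differentiableAt_primitive ht).hasDerivAt).unique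
    ((hasDerivAt_const t 0).congr_of_eventuallyEq hzero)
  linarith

/-- The line through `γ t` that is orthogonal to `γ t` is the polar line of the inverse of `γ t`,
and it is tangent to the primitive at the point that corresponds to `γ t`. -/
theorem inversion_mem_zeros_dual {q : QuadEq} (h : IsNoSilhouetteArc S γ ν I)
    (hprim : primitiveLocus S ⊆ q.zeros) (ht : t ∈ I)
    (hreg : deriv (fun s => primitive (γ s) (ν s)) t ≠ 0) :
    EuclideanGeometry.inversion 0 1 (γ t) ∈ q.dual.zeros := by
  have hr := (sq_add_sq_pos (h.ne_zero ht)).ne'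
  set y := primitive (γ t) (ν t)
  set y' := deriv (fun s => primitive (γ s) (ν s)) t
  have hinner : inner ℝ y (EuclideanGeometry.inversion 0 1 (γ t)) = 1 := by
    have hyγ := inner_primitive_self (h.inner_ne_zero t ht)
    rw [norm_sq_eq, inner_eq] at hyγ
    rw [inner_eq, inversion_apply, inversion_apply]
    field_simp
    linear_combination hyγ
  obtain ⟨k, hk⟩ := exists_eq_smul_quarterTurn hreg
    (by rw [real_inner_comm]; exact h.inner_deriv_primitive ht)
  have hpolar : q.polar y (-γ t 1) (γ t 0) = 0 := by
    rw [hk, PiLp.smul_apply, PiLp.smul_apply, quarterTurn_zero, quarterTurn_one]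
    have := h.polar_deriv_primitive hprim ht
    simp only [QuadEq.polar, smul_eq_mul] at this ⊢
    linear_combination -k * this
  rw [QuadEq.mem_zeros, q.eval_dual hinner,
    QuadEq.mem_zeros.mp (hprim (h.primitive_mem_primitiveLocus ht)), zero_mul, sub_zero,
    inversion_apply, inversion_apply]
  simp only [QuadEq.polar, smul_eq_mul] at hpolar ⊢
  field_simp
  rw [mul_zero, pow_eq_zero_iff two_ne_zero]
  linear_combination hpolar

theorem mono (h : IsNoSilhouetteArc S γ ν I) {J : Set ℝ} (hJ : IsOpen J) (hJI : J ⊆ I) :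
    IsNoSilhouetteArc S γ ν J where
  isOpen := hJ
  isLegendrianOn := ⟨h.isLegendrianOn.1.mono hJI, h.isLegendrianOn.2.1.mono hJI,
    fun t ht => h.isLegendrianOn.2.2 t (hJI ht)⟩
  injOn := h.injOn.mono hJI
  mapsTo := h.mapsTo.mono_left hJI
  inner_ne_zero t ht := h.inner_ne_zero t (hJI ht)

theorem infinite_image (h : IsNoSilhouetteArc S γ ν I) (hI : I.Nonempty) : (γ '' I).Infinite :=
  have ⟨_, ht⟩ := hI
  (infinite_of_mem_nhds _ (h.isOpen.mem_nhds ht)).image h.injOn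

end IsNoSilhouetteArc

theorem exists_isNoSilhouetteArc {S : Set Plane} {x : Plane} (h : x ∈ noSilhouettePart S) :
    ∃ γ ν I, IsNoSilhouetteArc S γ ν I ∧ ∃ t ∈ I, γ t = x := by
  obtain ⟨n, ⟨γ, ν, t₀, ε, hε, hL, hinj, hmaps, hx, hn⟩, h0⟩ := h
  have hmem : t₀ ∈ Set.Ioo (t₀ - ε) (t₀ + ε) := ⟨by linarith, by linarith⟩
  have hopen : IsOpen (Set.Ioo (t₀ - ε) (t₀ + ε) ∩ (fun t => inner ℝ (γ t) (ν t)) ⁻¹' {0}ᶜ) :=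
    (hL.1.continuousOn.inner hL.2.1.continuousOn).isOpen_inter_preimage isOpen_Ioo
      isOpen_compl_singleton
  have hsub := Set.inter_subset_left (s := Set.Ioo (t₀ - ε) (t₀ + ε))
    (t := (fun t => inner ℝ (γ t) (ν t)) ⁻¹' {0}ᶜ)
  refine ⟨γ, ν, _, ⟨hopen, ⟨hL.1.mono hsub, hL.2.1.mono hsub, fun t ht => hL.2.2 t ht.1⟩,
    hinj.mono hsub, hmaps.mono_left hsub, fun t ht => ht.2⟩, t₀, ⟨hmem, ?_⟩, hx⟩
  simpa [hx, hn] using h0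

theorem noSilhouettePart_subset (S : Set Plane) : noSilhouettePart S ⊆ S := by
  intro x hx
  obtain ⟨γ, ν, I, h, t, ht, rfl⟩ := exists_isNoSilhouetteArc hx
  exact h.mapsTo ht

theorem nonempty_noSilhouettePart_iff {S : Set Plane} :
    (noSilhouettePart S).Nonempty ↔ (primitiveLocus S).Nonempty :=
  ⟨fun ⟨x, n, hmem, h0⟩ => ⟨_, x, n, hmem, h0, rfl⟩, fun ⟨_, x, n, hmem, h0, _⟩ => ⟨x, n, hmem, h0⟩⟩

theorem zero_notMem_noSilhouettePart (S : Set Plane) : (0 : Plane) ∉ noSilhouettePart S := by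
  rintro ⟨n, -, h⟩
  exact h (inner_zero_left n)

theorem noSilhouettePart_infinite {S : Set Plane} (h : (noSilhouettePart S).Nonempty) :
    (noSilhouettePart S).Infinite := by
  obtain ⟨x, hx⟩ := h
  obtain ⟨γ, ν, I, h, t, ht, -⟩ := exists_isNoSilhouetteArc hx
  refine (h.infinite_image ⟨t, ht⟩).mono ?_
  rintro _ ⟨s, hs, rfl⟩
  exact h.mem_noSilhouettePart hs

theorem sphere_half_eq (y : Plane) :
    Metric.sphere ((1 / 2 : ℝ) • y) (‖y‖ / 2) = {x : Plane | ‖x‖ ^ 2 = inner ℝ y x} := by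
  ext x
  have hsq : ‖x - (1 / 2 : ℝ) • y‖ ^ 2 = ‖x‖ ^ 2 - inner ℝ y x + (‖y‖ / 2) ^ 2 := by
    rw [norm_sub_sq_real, inner_smul_right, norm_smul, real_inner_comm]
    norm_num
    ring
  rw [mem_sphere_iff_norm, Set.mem_ofPred_eq, ← sq_eq_sq₀ (by positivity) (by positivity), hsq]
  constructor <;> intro h <;> linarith

theorem puncturedInversion_noSilhouettePart_subset {q : QuadEq} {F : MvPolynomial (Fin 2) ℝ}
    (hnocircle : ∀ (p : Plane) (r : ℝ), 0 < r → (0 : Plane) ∈ Metric.sphere p r →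
      ¬ Metric.sphere p r ⊆ polyZeros F)
    (hprim : primitiveLocus (polyZeros F) ⊆ q.zeros) :
    puncturedInversion (noSilhouettePart (polyZeros F)) ⊆ q.dual.zeros := by
  rintro _ ⟨x, ⟨hx, -⟩, rfl⟩
  obtain ⟨γ, ν, I, h, t₀, ht₀, rfl⟩ := exists_isNoSilhouetteArc hx
  by_contra hnot
  have hcont : ContinuousAt (fun t => q.dual.eval (EuclideanGeometry.inversion 0 1 (γ t))) t₀ := by
    have hinv := ContinuousAt.inversion continuousAt_const (continuousAt_const (y := (1 : ℝ)))
      (h.differentiableAt ht₀).continuousAt (h.ne_zero ht₀)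
    unfold QuadEq.eval
    fun_prop
  obtain ⟨η, hη, hball⟩ := Metric.eventually_nhds_iff_ball.mp
    ((hcont.eventually_ne hnot).and (h.isOpen.mem_nhds ht₀))
  have harc := h.mono (Metric.isOpen_ball (x := t₀) (ε := η)) fun t ht => (hball t ht).2
  have hconst : ∀ t ∈ Metric.ball t₀ η, primitive (γ t) (ν t) = primitive (γ t₀) (ν t₀) :=
    fun t ht => Metric.isOpen_ball.is_const_of_deriv_eq_zero (convex_ball t₀ η).isPreconnected
      (fun s hs => (harc.differentiableAt_primitive hs).differentiableWithinAt)
      (fun s hs => by_contra fun hne => (hball s hs).1 (harc.inversion_mem_zeros_dual hprim hs hne))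
      ht (Metric.mem_ball_self hη)
  set y := primitive (γ t₀) (ν t₀)
  have hy : y ≠ 0 := h.primitive_ne_zero ht₀
  refine hnocircle ((1 / 2 : ℝ) • y) (‖y‖ / 2) (by positivity) ?_ ?_
  · rw [sphere_half_eq]
    simp
  · rw [sphere_half_eq]
    refine circle_subset_polyZeros hy
      ((harc.infinite_image ⟨t₀, Metric.mem_ball_self hη⟩).mono ?_)
    rintro _ ⟨t, ht, rfl⟩
    refine ⟨?_, harc.mapsTo ht⟩
    rw [Set.mem_ofPred_eq, ← hconst t ht, inner_primitive_self (harc.inner_ne_zero t ht)]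

/-! ### The equation of the curve -/

namespace QuadEq

theorem isClosed_zeros (q : QuadEq) : IsClosed q.zeros :=
  isClosed_eq (by fun_prop) continuous_const

theorem isClosed_invZeros (q : QuadEq) : IsClosed q.invZeros :=
  isClosed_eq (by unfold invEval; fun_prop) continuous_const

theorem invZeros_diff_zero_of_circle {q : QuadEq} (h1 : q.a₁₁ = q.a₂₂) (h2 : q.a₁₂ = 0)
    (h0 : q.a₁₁ ≠ 0) : q.invZeros \ {0} =
      {x : Plane | q.c * (x 0 ^ 2 + x 1 ^ 2) + 2 * q.a₁ * x 0 + 2 * q.a₂ * x 1 + q.a₁₁ = 0} := by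
  ext x
  have hfactor : q.invEval x = (x 0 ^ 2 + x 1 ^ 2) *
      (q.c * (x 0 ^ 2 + x 1 ^ 2) + 2 * q.a₁ * x 0 + 2 * q.a₂ * x 1 + q.a₁₁) := by
    rw [invEval, ← h1, h2]; ring
  rw [Set.mem_sdiff, invZeros, Set.mem_ofPred_eq, Set.mem_ofPred_eq, Set.mem_singleton_iff, hfactor]
  constructor
  · rintro ⟨h, hx⟩
    exact (mul_eq_zero.mp h).resolve_left (sq_add_sq_pos hx).ne'
  · intro h
    refine ⟨by rw [h, mul_zero], ?_⟩
    rintro rfl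
    exact h0 (by simpa using h)

theorem isLine_or_sphere_of_circle {q : QuadEq} (hq : q.det ≠ 0) (h1 : q.a₁₁ = q.a₂₂)
    (h2 : q.a₁₂ = 0) (hinf : (q.invZeros \ {0}).Infinite) :
    IsLine (q.invZeros \ {0}) ∨
      ∃ (p : Plane) (r : ℝ), 0 < r ∧ q.invZeros \ {0} = Metric.sphere p r := by
  have h0 : q.a₁₁ ≠ 0 := by
    contrapose! hq
    rw [det, ← h1, h2, hq]; ring
  rw [invZeros_diff_zero_of_circle h1 h2 h0] at hinf ⊢
  by_cases hc : q.c = 0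
  · left
    refine ⟨2 * q.a₁, 2 * q.a₂, q.a₁₁, ?_, by simp only [hc, zero_mul, zero_add]⟩
    contrapose! hq
    rw [det, hc, h2]
    linear_combination -(q.a₁₁ * q.a₂ / 2) * hq.2 - (q.a₂₂ * q.a₁ / 2) * hq.1
  · right
    set p : Plane := !₂[-q.a₁ / q.c, -q.a₂ / q.c] with hp
    obtain ⟨u, hu, hup⟩ := hinf.exists_notMem_finite (Set.finite_singleton p)
    refine ⟨p, ‖u - p‖, norm_pos_iff.mpr (sub_ne_zero.mpr hup), ?_⟩
    ext x
    rw [mem_sphere_iff_norm, ← sq_eq_sq₀ (norm_nonneg _) (norm_nonneg _), norm_sq_eq, norm_sq_eq]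
    rw [Set.mem_ofPred_eq] at hu ⊢
    simp only [hp, PiLp.sub_apply, Matrix.cons_val_zero, Matrix.cons_val_one]
    field_simp
    constructor <;> intro h
    · linear_combination q.c * (h - hu)
    · exact mul_left_cancel₀ hc (by linear_combination h + q.c * hu)

end QuadEq

theorem noSilhouettePart_subset_invZeros {q : QuadEq} {F : MvPolynomial (Fin 2) ℝ}
    (hnocircle : ∀ (p : Plane) (r : ℝ), 0 < r → (0 : Plane) ∈ Metric.sphere p r →
      ¬ Metric.sphere p r ⊆ polyZeros F)
    (hprim : primitiveLocus (polyZeros F) ⊆ q.zeros) :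
    noSilhouettePart (polyZeros F) ⊆ q.dual.invZeros \ {0} := by
  intro x hx
  have hx0 : x ≠ 0 := fun h => zero_notMem_noSilhouettePart _ (h ▸ hx)
  exact ⟨(q.dual.inversion_mem_zeros_iff hx0).mp
    (puncturedInversion_noSilhouettePart_subset hnocircle hprim ⟨x, ⟨hx, hx0⟩, rfl⟩), hx0⟩

theorem zeros_dual_infinite {Γ : Set Plane} {q : QuadEq} (hΓ : IsAlgebraicCurve Γ)
    (hnocircle : ∀ (p : Plane) (r : ℝ), 0 < r → (0 : Plane) ∈ Metric.sphere p r →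
      ¬ Metric.sphere p r ⊆ Γ)
    (hprim : primitiveLocus Γ ⊆ q.zeros) (hne : (noSilhouettePart Γ).Nonempty) :
    q.dual.zeros.Infinite := by
  obtain ⟨F, -, rfl⟩ := hΓ
  have himage := (noSilhouettePart_infinite hne).image
    (EuclideanGeometry.inversion_injective (0 : Plane) one_ne_zero).injOn
  rw [← Set.sdiff_singleton_eq_self (zero_notMem_noSilhouettePart (polyZeros F))] at himage
  exact himage.mono (puncturedInversion_noSilhouettePart_subset hnocircle hprim)

theorem eq_invZeros_dual {Γ : Set Plane} {q : QuadEq} (hΓ : IsAlgebraicCurve Γ)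
    (hdense : Γ \ {0} ⊆ closure (noSilhouettePart Γ))
    (hnocircle : ∀ (p : Plane) (r : ℝ), 0 < r → (0 : Plane) ∈ Metric.sphere p r →
      ¬ Metric.sphere p r ⊆ Γ)
    (hline : ¬ IsLine Γ)
    (hcircle : ∀ (p : Plane) (r : ℝ), 0 < r → Γ ≠ Metric.sphere p r)
    (hq : q.det ≠ 0) (hprim : primitiveLocus Γ ⊆ q.zeros) (hne : (noSilhouettePart Γ).Nonempty) :
    Γ = q.dual.invZeros := by
  obtain ⟨F, -, rfl⟩ := hΓ
  have hdual := QuadEq.det_dual_ne_zero hq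
  have hns := noSilhouettePart_subset_invZeros hnocircle hprim
  have hns' := noSilhouettePart_subset (polyZeros F)
  have hinter : (puncturedInversion q.dual.zeros ∩ polyZeros F).Infinite := by
    rw [QuadEq.puncturedInversion_zeros]
    exact (noSilhouettePart_infinite hne).mono (Set.subset_inter hns hns')
  have hpunct : polyZeros F \ {0} = q.dual.invZeros \ {0} := by
    apply Set.Subset.antisymm
    · exact fun x hx => ⟨closure_minimal (hns.trans Set.sdiff_subset)
        q.dual.isClosed_invZeros (hdense hx), hx.2⟩
    · rw [← QuadEq.puncturedInversion_zeros]
      exact fun x hx => ⟨QuadEq.puncturedInversion_subset_polyZeros hdual hinter hx,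
        (mem_puncturedInversion.mp hx).1⟩
  have hinf : (polyZeros F \ {0}).Infinite :=
    (noSilhouettePart_infinite hne).mono fun x hx => ⟨hns' hx, (hns hx).2⟩
  have h0 : (0 : Plane) ∈ polyZeros F := by
    by_cases hcirc : q.dual.a₁₁ = q.dual.a₂₂ ∧ q.dual.a₁₂ = 0
    · by_contra h0
      rw [Set.sdiff_singleton_eq_self h0] at hpunct hinf
      rcases QuadEq.isLine_or_sphere_of_circle hdual hcirc.1 hcirc.2 (hpunct ▸ hinf) with
        h | ⟨p, r, hr, h⟩
      · exact hline (hpunct ▸ h)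
      · exact hcircle p r hr (hpunct.trans h)
    · exact QuadEq.zero_mem_polyZeros hdual hcirc hinter
  rw [← Set.insert_eq_of_mem h0, ← Set.insert_eq_of_mem q.dual.zero_mem_invZeros,
    ← Set.insert_sdiff_singleton, hpunct, Set.insert_sdiff_singleton]

/-! ### The inversion of the curve -/

namespace QuadEq

theorem gradient_ne_zero {q : QuadEq} (hq : q.det ≠ 0) {u : Plane} (hu : u ∈ q.zeros) :
    q.a₁₁ * u 0 + q.a₁₂ * u 1 + q.a₁ ≠ 0 ∨ q.a₁₂ * u 0 + q.a₂₂ * u 1 + q.a₂ ≠ 0 := by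
  contrapose! hq
  obtain ⟨h0, h1⟩ := hq
  rw [mem_zeros, eval] at hu
  rw [det]
  linear_combination (q.a₁₁ * q.a₂₂ - q.a₁₂ ^ 2) * (hu - u 0 * h0 - u 1 * h1)
    + (q.a₁₂ * q.a₂ - q.a₂₂ * q.a₁) * h0 - (q.a₁₁ * q.a₂ - q.a₁₂ * q.a₁) * h1

theorem polar_normal_ne_zero {q : QuadEq} (hq : q.det ≠ 0) {u e : Plane} (hu : u ∈ q.zeros)
    (he : e ≠ 0) (h : q.polar u (e 0) (e 1) = 0) : q.polar u (-e 1) (e 0) ≠ 0 := by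
  intro h'
  have hN := (sq_add_sq_pos he).ne'
  simp only [polar, smul_eq_mul] at h h'
  rcases gradient_ne_zero hq hu with hg | hg <;> refine mul_ne_zero hN hg ?_
  · linear_combination e 0 * h - e 1 * h'
  · linear_combination e 1 * h + e 0 * h'

/-- Near `u`, the conic is parametrized by the directions `e + t • quarterTurn e` of its secants
through `u`, where `e` is the tangent direction. -/
theorem mem_closure_zeros_diff {q : QuadEq} (hq : q.det ≠ 0) {u : Plane} (hu : u ∈ q.zeros) :
    u ∈ closure (q.zeros \ {u}) := by
  obtain ⟨e, he, htangent⟩ := q.exists_polar_eq_zero u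
  have hform := form_ne_zero hq hu he htangent
  set d : ℝ → Plane := fun t => e + t • quarterTurn e with hd
  have hdcont : Continuous d := by fun_prop
  have hpolar (t : ℝ) : q.polar u (d t 0) (d t 1) = t * q.polar u (-e 1) (e 0) := by
    simp only [hd, polar, PiLp.add_apply, PiLp.smul_apply, smul_eq_mul, quarterTurn_zero,
      quarterTurn_one] at htangent ⊢
    linear_combination htangent
  have hnormal := polar_normal_ne_zero hq hu he htangent
  set f : ℝ → Plane := fun t =>
    u + (-2 * (t * q.polar u (-e 1) (e 0)) / q.form (d t 0) (d t 1)) • d t with hf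
  have hformcont : Continuous fun t => q.form (d t 0) (d t 1) := by
    unfold form
    fun_prop
  have hform0 : q.form (d 0 0) (d 0 1) ≠ 0 := by simpa [hd] using hform
  have hfcont : ContinuousAt f 0 := by
    have := hformcont.continuousAt.inv₀ hform0
    fun_prop
  have htendsto : Filter.Tendsto f (nhdsWithin 0 {0}ᶜ) (nhds u) := by
    have hf0 : f 0 = u := by simp [hf]
    exact hf0 ▸ hfcont.tendsto.mono_left nhdsWithin_le_nhds
  refine mem_closure_of_tendsto htendsto ?_
  filter_upwards [(hformcont.continuousAt.eventually_ne hform0).filter_mono nhdsWithin_le_nhds,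
    self_mem_nhdsWithin] with t hformt ht
  constructor
  · rw [mem_zeros, hf, eval_add_smul, hpolar, mem_zeros.mp hu]
    field_simp
    ring
  · have hdt : d t ≠ 0 := fun h => hformt (by simp [h, form])
    simp only [hf, Set.mem_singleton_iff, add_eq_left]
    exact smul_ne_zero (div_ne_zero (mul_ne_zero (by norm_num) (mul_ne_zero ht hnormal)) hformt) hdt

theorem closure_zeros_diff {q : QuadEq} (hq : q.det ≠ 0) (u : Plane) :
    closure (q.zeros \ {u}) = q.zeros := by
  refine (closure_minimal Set.sdiff_subset q.isClosed_zeros).antisymm fun x hx => ?_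
  by_cases hxu : x = u
  · rw [← hxu]
    exact mem_closure_zeros_diff hq hx
  · exact subset_closure ⟨hx, hxu⟩

theorem curveInversion_invZeros {q : QuadEq} (hq : q.det ≠ 0) :
    curveInversion q.invZeros = q.zeros := by
  rw [curveInversion, puncturedInversion_invZeros, closure_zeros_diff hq]

end QuadEq

/-! ### The degree of the curve -/

section UpperBound

open MvPolynomial

namespace QuadEq

/-- The equation of the inverse of a conic, as a polynomial. -/
def invPoly (q : QuadEq) : MvPolynomial (Fin 2) ℝ :=
  C q.c * (X 0 ^ 2 + X 1 ^ 2) ^ 2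
    + (C (2 * q.a₁) * ((X 0 ^ 2 + X 1 ^ 2) * X 0) + C (2 * q.a₂) * ((X 0 ^ 2 + X 1 ^ 2) * X 1)
      + (C q.a₁₁ * X 0 ^ 2 + C (2 * q.a₁₂) * (X 0 * X 1) + C q.a₂₂ * X 1 ^ 2))

theorem polyZeros_invPoly (q : QuadEq) : polyZeros q.invPoly = q.invZeros := by
  ext x
  have heval : MvPolynomial.eval (fun i => x i) q.invPoly = q.invEval x := by
    simp only [invPoly, invEval, map_add, map_mul, map_pow, eval_X, eval_C]
    ring
  rw [polyZeros, Set.mem_ofPred_eq, heval]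
  rfl

theorem totalDegree_invPoly_le (q : QuadEq) :
    q.invPoly.totalDegree ≤ 4 ∧ (q.c = 0 → q.invPoly.totalDegree ≤ 3) := by
  have hX (i : Fin 2) : (X i : MvPolynomial (Fin 2) ℝ).IsHomogeneous 1 := isHomogeneous_X ℝ i
  have hR : (X 0 ^ 2 + X 1 ^ 2 : MvPolynomial (Fin 2) ℝ).IsHomogeneous 2 :=
    ((hX 0).pow 2).add ((hX 1).pow 2)
  have hcubic := (((hR.mul (hX 0)).C_mul (2 * q.a₁)).add
    ((hR.mul (hX 1)).C_mul (2 * q.a₂))).totalDegree_le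
  have hquad := (((((hX 0).pow 2).C_mul q.a₁₁).add (((hX 0).mul (hX 1)).C_mul (2 * q.a₁₂))).add
    (((hX 1).pow 2).C_mul q.a₂₂)).totalDegree_le
  have hlow := (totalDegree_add _ _).trans (max_le hcubic (hquad.trans (by norm_num)))
  constructor
  · exact (totalDegree_add _ _).trans
      (max_le ((hR.pow 2).C_mul q.c).totalDegree_le (hlow.trans (by norm_num)))
  · intro hc
    rw [invPoly, hc, C_0, zero_mul, zero_add]
    exact hlow

theorem invPoly_ne_zero {q : QuadEq} (hq : q.det ≠ 0) : q.invPoly ≠ 0 := by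
  intro h
  have huniv : q.invZeros = Set.univ := by
    rw [← polyZeros_invPoly, h]
    simp [polyZeros]
  refine not_line_subset hq (l := {x | 1 * x 0 + 0 * x 1 + -1 = 0}) ⟨1, 0, -1, by simp, rfl⟩ ?_
  intro x hx
  have hx0 : x ≠ 0 := by
    rintro rfl
    simp at hx
  have hmem : x ∈ q.zeros \ {0} := by
    rw [← puncturedInversion_invZeros, huniv, mem_puncturedInversion]
    exact ⟨hx0, Set.mem_univ _⟩
  exact hmem.1

end QuadEq

theorem exists_eval_eq_of_totalDegree_le_two {F : MvPolynomial (Fin 2) ℝ}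
    (hF : F.totalDegree ≤ 2) :
    ∃ q : QuadEq, ∀ x : Plane, MvPolynomial.eval (fun i => x i) F = q.eval x := by
  have hsum : ∃ q : QuadEq,
      (∑ m ∈ F.support, fun x : Plane => F.coeff m * ∏ i, x i ^ m i) = q.eval := by
    refine Finset.sum_induction _ (fun g => ∃ q : QuadEq, g = q.eval) ?_ ?_ ?_
    · rintro _ _ ⟨q, rfl⟩ ⟨q', rfl⟩
      refine ⟨⟨q.a₁₁ + q'.a₁₁, q.a₂₂ + q'.a₂₂, q.a₁₂ + q'.a₁₂, q.a₁ + q'.a₁, q.a₂ + q'.a₂,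
        q.c + q'.c⟩, ?_⟩
      ext x; simp only [QuadEq.eval, Pi.add_apply]; ring
    · exact ⟨⟨0, 0, 0, 0, 0, 0⟩, by ext x; simp [QuadEq.eval]⟩
    · intro m hm
      have hdeg := (le_totalDegree hm).trans hF
      rw [Finsupp.sum_fintype _ _ (fun _ => rfl), Fin.sum_univ_two] at hdeg
      simp only [Fin.prod_univ_two]
      generalize F.coeff m = k
      obtain h | h | h | h | h | h : m 0 = 0 ∧ m 1 = 0 ∨ m 0 = 1 ∧ m 1 = 0 ∨ m 0 = 0 ∧ m 1 = 1 ∨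
          m 0 = 2 ∧ m 1 = 0 ∨ m 0 = 1 ∧ m 1 = 1 ∨ m 0 = 0 ∧ m 1 = 2 := by omega
      all_goals simp only [h.1, h.2]
      · exact ⟨⟨0, 0, 0, 0, 0, k⟩, by ext x; simp only [QuadEq.eval]; ring⟩
      · exact ⟨⟨0, 0, 0, k / 2, 0, 0⟩, by ext x; simp only [QuadEq.eval]; ring⟩
      · exact ⟨⟨0, 0, 0, 0, k / 2, 0⟩, by ext x; simp only [QuadEq.eval]; ring⟩
      · exact ⟨⟨k, 0, 0, 0, 0, 0⟩, by ext x; simp only [QuadEq.eval]; ring⟩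
      · exact ⟨⟨0, 0, k / 2, 0, 0, 0⟩, by ext x; simp only [QuadEq.eval]; ring⟩
      · exact ⟨⟨0, k, 0, 0, 0, 0⟩, by ext x; simp only [QuadEq.eval]; ring⟩
  obtain ⟨q, hq⟩ := hsum
  exact ⟨q, fun x => by rw [← hq, eval_eq', Finset.sum_apply]⟩

end UpperBound

theorem exists_cubic_eq_zero {a : ℝ} (ha : a ≠ 0) (b c d : ℝ) :
    ∃ t : ℝ, a * t ^ 3 + b * t ^ 2 + c * t + d = 0 := by
  wlog hpos : 0 < a generalizing a b c d
  · obtain ⟨t, ht⟩ := this (neg_ne_zero.mpr ha) (-b) (-c) (-d) (by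
      rw [neg_pos]; exact lt_of_le_of_ne (not_lt.mp hpos) ha)
    exact ⟨t, by linear_combination -ht⟩
  have htop (b c d : ℝ) : Filter.Tendsto (fun t : ℝ => a * t ^ 3 + b * t ^ 2 + c * t + d)
      Filter.atTop Filter.atTop := by
    have := Polynomial.tendsto_atTop_of_leadingCoeff_nonneg (Cubic.toPoly ⟨a, b, c, d⟩)
      (by rw [Cubic.degree_of_a_ne_zero ha]; norm_num)
      (by rw [Cubic.leadingCoeff_of_a_ne_zero ha]; exact hpos.le)
    simpa [Cubic.toPoly] using this
  obtain ⟨t, ht⟩ := ((htop b c d).eventually_ge_atTop 0).exists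
  obtain ⟨s, hs⟩ := ((htop (-b) c (-d)).eventually_ge_atTop 0).exists
  exact mem_range_of_exists_le_of_exists_ge
    (f := fun t : ℝ => a * t ^ 3 + b * t ^ 2 + c * t + d) (by fun_prop)
    ⟨-s, by linarith⟩ ⟨t, ht⟩

theorem eventually_add_mul_ne_zero {α β : ℝ} (hβ : β ≠ 0) :
    ∀ᶠ s in nhdsWithin (0 : ℝ) {0}ᶜ, α + s * β ≠ 0 := by
  by_cases hα : α = 0
  · filter_upwards [self_mem_nhdsWithin] with s hs
    rw [hα, zero_add]
    exact mul_ne_zero hs hβ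
  · have hcont : ContinuousAt (fun s : ℝ => α + s * β) 0 := by fun_prop
    exact (hcont.eventually_ne (by simpa using hα)).filter_mono nhdsWithin_le_nhds

namespace QuadEq

theorem det_nonneg {q : QuadEq} {l : Plane} (hl : l ≠ 0)
    (h : ∀ y : Plane, inner ℝ l y ≠ 0 → 0 ≤ q.eval y) : 0 ≤ q.det := by
  set M : Matrix (Fin 3) (Fin 3) ℝ :=
    !![q.a₁₁, q.a₁₂, q.a₁; q.a₁₂, q.a₂₂, q.a₂; q.a₁, q.a₂, q.c] with hM
  set Q : (Fin 3 → ℝ) → ℝ := fun k => k ⬝ᵥ M.mulVec k with hQ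
  have hgeneric (k : Fin 3 → ℝ) (hk : k 2 ≠ 0) (hlk : l 0 * k 0 + l 1 * k 1 ≠ 0) : 0 ≤ Q k := by
    have hval : Q k = k 2 ^ 2 * q.eval !₂[k 0 / k 2, k 1 / k 2] := by
      simp only [hQ, hM, eval, dotProduct, Matrix.mulVec, Fin.sum_univ_three, Matrix.of_apply,
        Matrix.cons_val]
      field_simp
      ring
    rw [hval]
    refine mul_nonneg (sq_nonneg _) (h _ ?_)
    simp only [inner_eq, Matrix.cons_val_zero, Matrix.cons_val_one]
    contrapose! hlk
    field_simp at hlk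
    linear_combination hlk
  have hnonneg (k : Fin 3 → ℝ) : 0 ≤ Q k := by
    have hcont : Continuous fun s : ℝ => Q (k + s • ![l 0, l 1, 1]) := by
      simp only [hQ]
      fun_prop
    have hlim : Filter.Tendsto (fun s : ℝ => Q (k + s • ![l 0, l 1, 1]))
        (nhdsWithin 0 {0}ᶜ) (nhds (Q k)) := by
      simpa using (hcont.tendsto 0).mono_left nhdsWithin_le_nhds
    refine ge_of_tendsto hlim ?_
    filter_upwards [eventually_add_mul_ne_zero (α := k 2) one_ne_zero,
      eventually_add_mul_ne_zero (α := l 0 * k 0 + l 1 * k 1) (sq_add_sq_pos hl).ne'] with s h2 hls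
    refine hgeneric _ (by simpa using h2) ?_
    simp only [Pi.add_apply, Pi.smul_apply, Matrix.cons_val_zero, Matrix.cons_val_one, smul_eq_mul]
    convert hls using 1
    ring
  have hpsd : M.PosSemidef := .of_dotProduct_mulVec_nonneg
    (by ext i j; fin_cases i <;> fin_cases j <;> rfl) hnonneg
  have hdet := hpsd.det_nonneg
  rw [hM, Matrix.det_fin_three] at hdet
  simp only [Matrix.of_apply, Matrix.cons_val] at hdet
  rw [det]
  linarith

theorem exists_mem_invZeros_inner_eq_one {g : QuadEq} (hg : g.c = 0) {y : Plane}
    (hy : inner ℝ (!₂[g.a₂, -g.a₁] : Plane) y ≠ 0) : ∃ z ∈ g.invZeros, inner ℝ z y = 1 := by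
  have hy0 : y ≠ 0 := by
    rintro rfl
    exact hy (inner_zero_right _)
  have hn := (sq_add_sq_pos hy0).ne'
  simp only [inner_eq, Matrix.cons_val_zero, Matrix.cons_val_one] at hy
  set n := y 0 ^ 2 + y 1 ^ 2 with hn_def
  set A := (g.a₁ * y 0 + g.a₂ * y 1) / n
  set B := g.a₂ * y 0 + -g.a₁ * y 1
  obtain ⟨t, ht⟩ := exists_cubic_eq_zero (a := 2 * n * B) (mul_ne_zero (by simpa using hn) hy)
    (2 * n * A + g.form (-y 1) (y 0)) (2 * B / n + 2 * g.polar ((1 / n) • y) (-y 1) (y 0) - 2 * B)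
    (2 * A / n + g.form (y 0 / n) (y 1 / n))
  refine ⟨(1 / n) • y + t • quarterTurn y, ?_, ?_⟩
  · rw [invZeros, Set.mem_ofPred_eq, ← ht]
    simp only [invEval, hg, form, polar, A, B, PiLp.add_apply, PiLp.smul_apply, smul_eq_mul,
      quarterTurn_zero, quarterTurn_one]
    field_simp
    rw [hn_def]
    ring
  · rw [inner_add_left, real_inner_smul_left, real_inner_smul_left,
      real_inner_comm y (quarterTurn y), inner_quarterTurn_self, real_inner_self_eq_norm_sq,
      norm_sq_eq, mul_zero, add_zero, one_div_mul_cancel hn]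

/-- If the punctured conic were the locus of a cubic `‖x‖² L(x) + Q(x)` without constant and
linear terms, then all lines except those in one direction would meet the conic, as cubics have
real roots; so the dual conic would be semidefinite. -/
theorem not_zeros_diff_zero_eq_invZeros {q : QuadEq} (hq : q.det ≠ 0) (hinf : q.zeros.Infinite)
    {g : QuadEq} (hg : g.c = 0) : q.zeros \ {0} ≠ g.invZeros \ {0} := by
  intro heq
  set l : Plane := !₂[g.a₂, -g.a₁]
  by_cases hl0 : l = 0
  · have h1 : g.a₁ = 0 := neg_eq_zero.mp (congrArg (· 1) hl0)
    have h2 : g.a₂ = 0 := congrArg (· 0) hl0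
    obtain ⟨x, hx, hx0⟩ := hinf.exists_notMem_finite (Set.finite_singleton (0 : Plane))
    have hgx : g.invEval x = 0 := (heq ▸ ⟨hx, hx0⟩ : x ∈ g.invZeros \ {0}).1
    have hcone (t : ℝ) (ht : t ≠ 0) : q.eval (0 + t • x) = 0 := by
      have hmem : t • x ∈ q.zeros \ {0} := by
        rw [heq]
        refine ⟨?_, smul_ne_zero ht hx0⟩
        simp only [invZeros, invEval, Set.mem_ofPred_eq, PiLp.smul_apply, smul_eq_mul, hg, h1,
          h2] at hgx ⊢
        linear_combination t ^ 2 * hgx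
      rw [zero_add]
      exact hmem.1
    refine not_line_subset hq (isLine_range_add_smul 0 hx0) (range_subset_zeros_iff.mpr ?_)
    have h1 := hcone 1 one_ne_zero
    have h2 := hcone 2 two_ne_zero
    have h3 := hcone (-1) (by norm_num)
    rw [eval_add_smul] at h1 h2 h3
    exact ⟨by linarith, by linarith, by linarith⟩
  · have hdual : 0 ≤ q.dual.det := det_nonneg hl0 fun y hy => by
      obtain ⟨z, hz, hzy⟩ := exists_mem_invZeros_inner_eq_one hg hy
      have hz0 : z ≠ 0 := by
        rintro rfl
        simp at hzy
      have hzq : z ∈ q.zeros \ {0} := heq ▸ ⟨hz, hz0⟩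
      rw [eval_dual q hzy, mem_zeros.mp hzq.1, zero_mul, sub_zero]
      positivity
    rw [det_dual] at hdual
    have := pow_pos (abs_pos.mpr hq) 2
    rw [sq_abs] at this
    linarith

theorem three_le_totalDegree {q : QuadEq} (hq : q.det ≠ 0) (hinf : q.zeros.Infinite)
    {F : MvPolynomial (Fin 2) ℝ} (hF : q.invZeros = polyZeros F) : 3 ≤ F.totalDegree := by
  by_contra! hlt
  obtain ⟨g, hg⟩ := exists_eval_eq_of_totalDegree_le_two (Nat.le_of_lt_succ hlt)
  have hzeros : q.invZeros = g.zeros := by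
    rw [hF, polyZeros]
    simp only [hg]
    rfl
  refine not_zeros_diff_zero_eq_invZeros hq hinf (g := g) ?_ ?_
  · have h0 := hzeros ▸ q.zero_mem_invZeros
    simpa [mem_zeros, eval] using h0
  · rw [← puncturedInversion_invZeros, hzeros, puncturedInversion_zeros]

theorem hasDegree_invZeros {q : QuadEq} (hq : q.det ≠ 0) (hinf : q.zeros.Infinite) :
    (HasDegree q.invZeros 3 ∨ HasDegree q.invZeros 4) ∧ (q.c = 0 → HasDegree q.invZeros 3) := by
  have hmem : q.invPoly.totalDegree ∈ {n : ℕ | ∃ F : MvPolynomial (Fin 2) ℝ, F ≠ 0 ∧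
      F.totalDegree = n ∧ q.invZeros = polyZeros F} :=
    ⟨_, invPoly_ne_zero hq, rfl, q.polyZeros_invPoly.symm⟩
  have hleast : HasDegree q.invZeros (sInf _) := ⟨Nat.sInf_mem ⟨_, hmem⟩, fun n => Nat.sInf_le⟩
  set d := sInf {n : ℕ | ∃ F : MvPolynomial (Fin 2) ℝ, F ≠ 0 ∧
      F.totalDegree = n ∧ q.invZeros = polyZeros F}
  have hlow : 3 ≤ d := by
    obtain ⟨F, -, hdeg, hF⟩ := hleast.1
    exact hdeg ▸ three_le_totalDegree hq hinf hF
  have hup : d ≤ q.invPoly.totalDegree := Nat.sInf_le hmem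
  obtain ⟨h4, h3⟩ := q.totalDegree_invPoly_le
  constructor
  · obtain hd | hd : d = 3 ∨ d = 4 := by omega
    · exact .inl (hd ▸ hleast)
    · exact .inr (hd ▸ hleast)
  · intro hc
    have hd : d = 3 := by have := h3 hc; omega
    exact hd ▸ hleast

end QuadEq

/-! ### Normal forms of singularities -/

theorem exists_isLocalModel {f : Plane → Plane} {f' : Plane →L[ℝ] Plane} {Ω S T : Set Plane}
    {x : Plane} (hΩ : IsOpen Ω) (hx : x ∈ Ω) (hf : ContDiffOn ℝ ∞ f Ω) (hfx : f x = 0)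
    (hf' : HasFDerivAt f f' x) (hinj : Function.Injective f') (hST : ∀ z ∈ Ω, z ∈ S ↔ f z ∈ T) :
    ∃ φ : OpenPartialHomeomorph Plane Plane, IsLocalModel φ S x T ∧ fderiv ℝ φ x = f' := by
  set e := (LinearEquiv.ofInjectiveEndo (f' : Plane →ₗ[ℝ] Plane) hinj).toContinuousLinearEquiv
  have he : HasFDerivAt f (e : Plane →L[ℝ] Plane) x := hf'
  have hcont (z : Plane) (hz : z ∈ Ω) : ContDiffAt ℝ ∞ f z := hf.contDiffAt (hΩ.mem_nhds hz)
  set Ω' := Ω ∩ fderiv ℝ f ⁻¹' Set.range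
    (ContinuousLinearEquiv.toContinuousLinearMap : (Plane ≃L[ℝ] Plane) → Plane →L[ℝ] Plane)
  have hΩ' : IsOpen Ω' :=
    (hf.continuousOn_fderiv_of_isOpen hΩ (by simp)).isOpen_inter_preimage hΩ
      ContinuousLinearEquiv.isOpen
  set φ := ((hcont x hx).toOpenPartialHomeomorph f he (by simp)).restrOpen Ω' hΩ'
  have hsrc : φ.source ⊆ Ω' := fun z hz => hz.2
  refine ⟨φ, ⟨⟨(hcont x hx).mem_toOpenPartialHomeomorph_source he (by simp), hx, e, he.fderiv.symm⟩,
    hfx, hf.mono fun z hz => (hsrc hz).1, fun y hy => ?_, ?_⟩, hf'.fderiv⟩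
  · obtain ⟨hyΩ, e', he'⟩ := hsrc (φ.map_target hy)
    refine (φ.contDiffAt_symm (f₀' := e') hy ?_ (hcont _ hyΩ)).contDiffWithinAt
    rw [he']
    exact ((hcont _ hyΩ).differentiableAt (by simp)).hasFDerivAt
  · ext y
    constructor
    · rintro ⟨z, ⟨hz, hzS⟩, rfl⟩
      exact ⟨φ.map_source hz, (hST z (hsrc hz).1).mp hzS⟩
    · rintro ⟨hy, hyT⟩
      refine ⟨φ.symm y, ⟨φ.map_target hy, (hST _ (hsrc (φ.map_target hy)).1).mpr ?_⟩,
        φ.right_inv hy⟩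
      rwa [← φ.right_inv hy] at hyT

/-- The vector-valued linear map with two given coordinates. -/
def linPair (ℓ₀ ℓ₁ : Plane →L[ℝ] ℝ) : Plane →L[ℝ] Plane :=
  ((EuclideanSpace.equiv (Fin 2) ℝ).symm : (Fin 2 → ℝ) →L[ℝ] Plane).comp
    (ContinuousLinearMap.pi ![ℓ₀, ℓ₁])

theorem linPair_apply (ℓ₀ ℓ₁ : Plane →L[ℝ] ℝ) (w : Plane) : linPair ℓ₀ ℓ₁ w = !₂[ℓ₀ w, ℓ₁ w] := by
  apply plane_ext <;> simp [linPair]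

theorem hasFDerivAt_pair {f₀ f₁ : Plane → ℝ} {ℓ₀ ℓ₁ : Plane →L[ℝ] ℝ} {x : Plane}
    (h₀ : HasFDerivAt f₀ ℓ₀ x) (h₁ : HasFDerivAt f₁ ℓ₁ x) :
    HasFDerivAt (fun z => (!₂[f₀ z, f₁ z] : Plane)) (linPair ℓ₀ ℓ₁) x := by
  rw [← hasFDerivWithinAt_univ, hasFDerivWithinAt_piLp]
  intro i; fin_cases i
  · exact h₀.hasFDerivWithinAt
  · exact h₁.hasFDerivWithinAt

theorem contDiffOn_pair {E : Type*} [NormedAddCommGroup E] [NormedSpace ℝ E] {f₀ f₁ : E → ℝ}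
    {Ω : Set E} (h₀ : ContDiffOn ℝ ∞ f₀ Ω) (h₁ : ContDiffOn ℝ ∞ f₁ Ω) :
    ContDiffOn ℝ ∞ (fun z => (!₂[f₀ z, f₁ z] : Plane)) Ω := by
  rw [contDiffOn_euclidean]
  intro i; fin_cases i <;> assumption

theorem hasFDerivAt_mul_of_eq_zero {U g : Plane → ℝ} {x : Plane} {g' : Plane →L[ℝ] ℝ}
    (hU : DifferentiableAt ℝ U x) (hg : HasFDerivAt g g' x) (h0 : g x = 0) :
    HasFDerivAt (fun z => U z * g z) (U x • g') x := by
  refine (hU.hasFDerivAt.mul hg).congr_fderiv ?_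
  rw [h0, zero_smul, add_zero]

theorem linPair_injective {ℓ₀ ℓ₁ : Plane →L[ℝ] ℝ} {d₀ d₁ : Plane} (h₀₀ : ℓ₀ d₀ ≠ 0)
    (h₀₁ : ℓ₀ d₁ = 0) (h₁₁ : ℓ₁ d₁ ≠ 0) : Function.Injective (linPair ℓ₀ ℓ₁) := by
  refine LinearMap.injective_iff_surjective (f := (linPair ℓ₀ ℓ₁ : Plane →ₗ[ℝ] Plane)).mpr ?_
  intro y
  refine ⟨(y 0 / ℓ₀ d₀) • d₀ + ((y 1 - y 0 / ℓ₀ d₀ * ℓ₁ d₀) / ℓ₁ d₁) • d₁, ?_⟩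
  rw [ContinuousLinearMap.coe_coe, linPair_apply]
  apply plane_ext
  · simp [h₀₁, div_mul_cancel₀ _ h₀₀]
  · simp [div_mul_cancel₀ _ h₁₁]

theorem isRegularAt_of_hasFDerivAt {P : Plane → ℝ} {P' : Plane →L[ℝ] ℝ} {S : Set Plane} {x : Plane}
    (hP : ContDiff ℝ ∞ P) (hS : ∀ z, z ∈ S ↔ P z = 0) (hx : x ∈ S) (hP' : HasFDerivAt P P' x)
    (hne : P' ≠ 0) : IsRegularAt S x := by
  obtain ⟨w, hw⟩ : ∃ w, P' w ≠ 0 := by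
    contrapose! hne
    ext w : 1
    exact hne w
  have hw0 : w ≠ 0 := by rintro rfl; exact hw (map_zero P')
  set ℓ : Plane →L[ℝ] ℝ := innerSL ℝ (quarterTurn w)
  have hℓw : ℓ w = 0 := (real_inner_comm _ _).trans (inner_quarterTurn_self w)
  have hℓJw : ℓ (quarterTurn w) ≠ 0 := by
    rwa [innerSL_apply_apply, inner_self_ne_zero, ← norm_ne_zero_iff, norm_quarterTurn,
      norm_ne_zero_iff]
  obtain ⟨φ, hφ, -⟩ := exists_isLocalModel (S := S) (T := {y | y 1 = 0}) isOpen_univ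
    (Set.mem_univ x)
    (contDiffOn_pair (ℓ.contDiff.sub contDiff_const).contDiffOn hP.contDiffOn)
    (plane_ext (sub_self (ℓ x)) ((hS x).mp hx)) (hasFDerivAt_pair (ℓ.hasFDerivAt.sub_const _) hP')
    (linPair_injective hℓJw hℓw hw) (fun z _ => hS z)
  exact ⟨φ, hφ⟩

/-- The root of larger modulus of `m² - 2 B m + A C = 0` depends smoothly on the point. -/
theorem exists_contDiffOn_root {A B C : Plane → ℝ} (hA : ContDiff ℝ ∞ A) (hB : ContDiff ℝ ∞ B)
    (hC : ContDiff ℝ ∞ C) : ∃ m : Plane → ℝ,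
      ContDiffOn ℝ ∞ m {z | B z ≠ 0 ∧ A z * C z < B z ^ 2} ∧
      ∀ z, B z ≠ 0 → A z * C z < B z ^ 2 → m z ≠ 0 ∧ m z ^ 2 + A z * C z = 2 * B z * m z := by
  have hpos (z : Plane) (h0 : B z ≠ 0) (h1 : A z * C z < B z ^ 2) :
      0 < 1 - A z * C z / B z ^ 2 := by
    rw [sub_pos, div_lt_one (by positivity)]
    exact h1
  refine ⟨fun z => B z * (1 + √(1 - A z * C z / B z ^ 2)), ?_, fun z h0 h1 => ⟨?_, ?_⟩⟩
  · refine hB.contDiffOn.mul (contDiffOn_const.add (ContDiffOn.sqrt ?_ ?_))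
    · exact contDiffOn_const.sub ((hA.mul hC).contDiffOn.div (hB.pow 2).contDiffOn
        fun z hz => pow_ne_zero 2 hz.1)
    · exact fun z hz => (hpos z hz.1 hz.2).ne'
  · positivity
  · have hs := Real.sq_sqrt (hpos z h0 h1).le
    have hAC : B z ^ 2 * (A z * C z / B z ^ 2) = A z * C z := by field_simp
    linear_combination B z ^ 2 * hs - hAC

/-- Here `f = 0` and `g = 0` are the tangents of the branches at `x`; completing the product
`A f² + 2 B f g + C g² = m (g + (A / m) f) (f + (C / m) g)` straightens both branches. -/
theorem hasNodeAt_of_eq {A B C f g : Plane → ℝ} {f' g' : Plane →L[ℝ] ℝ} {S : Set Plane}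
    {x d₁ d₂ : Plane} (hA : ContDiff ℝ ∞ A) (hB : ContDiff ℝ ∞ B) (hC : ContDiff ℝ ∞ C)
    (hf : ContDiff ℝ ∞ f) (hg : ContDiff ℝ ∞ g) (hAx : A x = 0) (hBx : B x ≠ 0) (hCx : C x = 0)
    (hfx : f x = 0) (hgx : g x = 0) (hf' : HasFDerivAt f f' x) (hg' : HasFDerivAt g g' x)
    (hfd₁ : f' d₁ = 0) (hgd₁ : g' d₁ ≠ 0) (hfd₂ : f' d₂ ≠ 0) (hgd₂ : g' d₂ = 0)
    (hS : ∀ z, z ∈ S ↔ A z * f z ^ 2 + 2 * B z * (f z * g z) + C z * g z ^ 2 = 0) :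
    HasNodeAt S x d₁ d₂ := by
  obtain ⟨m, hm, hmeq⟩ := exists_contDiffOn_root hA hB hC
  set Ω : Set Plane := {z | B z ≠ 0 ∧ A z * C z < B z ^ 2}
  have hΩ : IsOpen Ω := (isOpen_ne_fun hB.continuous continuous_const).inter
    (isOpen_lt (hA.mul hC).continuous (hB.pow 2).continuous)
  have hxΩ : x ∈ Ω := ⟨hBx, by rw [hAx, zero_mul]; positivity⟩
  have hdiv {D : Plane → ℝ} (hD : ContDiff ℝ ∞ D) : ContDiffOn ℝ ∞ (fun z => D z / m z) Ω :=
    hD.contDiffOn.div hm fun z hz => (hmeq z hz.1 hz.2).1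
  have hderiv {D h k : Plane → ℝ} {h' k' : Plane →L[ℝ] ℝ} (hD : ContDiff ℝ ∞ D) (hDx : D x = 0)
      (hh' : HasFDerivAt h h' x) (hk : k x = 0) (hk' : HasFDerivAt k k' x) :
      HasFDerivAt (fun z => h z + D z / m z * k z) h' x := by
    have hdiff := ((hdiv hD).contDiffAt (hΩ.mem_nhds hxΩ)).differentiableAt (by simp)
    refine (hh'.add (hasFDerivAt_mul_of_eq_zero hdiff hk' hk)).congr_fderiv ?_
    rw [hDx, zero_div, zero_smul, add_zero]
  have hstraight : ∀ z ∈ Ω,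
      z ∈ S ↔ (g z + A z / m z * f z) * (f z + C z / m z * g z) = 0 := by
    intro z hz
    obtain ⟨hm0, hroot⟩ := hmeq z hz.1 hz.2
    have hfactor : A z * f z ^ 2 + 2 * B z * (f z * g z) + C z * g z ^ 2
        = m z * ((g z + A z / m z * f z) * (f z + C z / m z * g z)) := by
      field_simp
      linear_combination -f z * g z * hroot
    rw [hS, hfactor, mul_eq_zero_iff_left hm0]
  obtain ⟨φ, hφ, hφ'⟩ := exists_isLocalModel (S := S) (T := {y | y 0 * y 1 = 0}) hΩ hxΩ
    (contDiffOn_pair (hg.contDiffOn.add ((hdiv hA).mul hf.contDiffOn))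
      (hf.contDiffOn.add ((hdiv hC).mul hg.contDiffOn)))
    (by apply plane_ext <;> simp [hfx, hgx])
    (hasFDerivAt_pair (hderiv hA hAx hg' hfx hf') (hderiv hC hCx hf' hgx hg'))
    (linPair_injective hgd₁ hgd₂ hfd₂) hstraight
  refine ⟨?_, ?_, φ, hφ, ?_, ?_⟩
  · rintro rfl; exact hgd₁ (map_zero g')
  · rintro rfl; exact hfd₂ (map_zero f')
  · rw [hφ', linPair_apply]; exact hfd₁
  · rw [hφ', linPair_apply]; exact hgd₂

theorem pow_three_eq_sq_mul_iff {m n W : ℝ} (hW : W ≠ 0) :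
    n ^ 3 = W * m ^ 2 ↔ ∃ t : ℝ, W * n = t ^ 2 ∧ W ^ 2 * m = t ^ 3 := by
  constructor
  · intro h
    by_cases hn : n = 0
    · have hm : m = 0 := by simpa [hn, hW] using h
      exact ⟨0, by simp [hn], by simp [hm]⟩
    · refine ⟨W * m / n, ?_, ?_⟩
      · field_simp; linear_combination h
      · field_simp; linear_combination m * h
  · rintro ⟨t, ht0, ht1⟩
    apply mul_left_cancel₀ (pow_ne_zero 3 hW)
    calc W ^ 3 * n ^ 3 = (W * n) ^ 3 := by ring
      _ = (W ^ 2 * m) ^ 2 := by rw [ht0, ht1]; ring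
      _ = W ^ 3 * (W * m ^ 2) := by ring

theorem hasOrdinaryCuspAt_of_eq {W m n : Plane → ℝ} {m' n' : Plane →L[ℝ] ℝ} {S Ω : Set Plane}
    {x d : Plane} (hΩ : IsOpen Ω) (hx : x ∈ Ω) (hW : ContDiff ℝ ∞ W) (hm : ContDiff ℝ ∞ m)
    (hn : ContDiff ℝ ∞ n) (hWx : W x ≠ 0) (hmx : m x = 0) (hnx : n x = 0)
    (hm' : HasFDerivAt m m' x) (hn' : HasFDerivAt n n' x)
    (hinj : Function.Injective (linPair n' m')) (hd : d ≠ 0) (hmd : m' d = 0)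
    (hS : ∀ z ∈ Ω, z ∈ S ↔ n z ^ 3 = W z * m z ^ 2) : HasOrdinaryCuspAt S x d := by
  have hdiff : DifferentiableAt ℝ W x := hW.differentiable (by simp) x
  have hinj' : Function.Injective (linPair (W x • n') (W x ^ 2 • m')) := by
    rw [injective_iff_map_eq_zero] at hinj ⊢
    intro y hy
    rw [linPair_apply] at hy
    have h0 : W x * n' y = 0 := congrArg (· 0) hy
    have h1 : W x ^ 2 * m' y = 0 := congrArg (· 1) hy
    apply hinj
    rw [linPair_apply, (mul_eq_zero.mp h0).resolve_left hWx,
      (mul_eq_zero.mp h1).resolve_left (pow_ne_zero 2 hWx)]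
    apply plane_ext <;> rfl
  obtain ⟨φ, hφ, hφ'⟩ := exists_isLocalModel (S := S)
    (T := {y | ∃ t : ℝ, y 0 = t ^ 2 ∧ y 1 = t ^ 3})
    (hΩ.inter (isOpen_ne_fun hW.continuous continuous_const)) ⟨hx, hWx⟩
    (contDiffOn_pair (hW.mul hn).contDiffOn ((hW.pow 2).mul hm).contDiffOn)
    (by apply plane_ext <;> simp [hmx, hnx])
    (hasFDerivAt_pair (hasFDerivAt_mul_of_eq_zero hdiff hn' hnx)
      (hasFDerivAt_mul_of_eq_zero (hdiff.pow 2) hm' hmx)) hinj'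
    (fun z hz => (hS z hz.1).trans (pow_three_eq_sq_mul_iff hz.2))
  refine ⟨hd, φ, hφ, ?_⟩
  rw [hφ', linPair_apply]
  simp [hmd]

/-! ### Singularities of the inverse of a conic -/

theorem hasFDerivAt_inner_add_norm_sq (e : Plane) (α k : ℝ) :
    HasFDerivAt (fun z : Plane => α * inner ℝ z e + k * ‖z‖ ^ 2) (α • innerSL ℝ e) 0 := by
  have he : HasFDerivAt (fun z : Plane => inner ℝ z e) (innerSL ℝ e) 0 := by
    simp only [real_inner_comm]
    exact (innerSL ℝ e).hasFDerivAt
  refine ((he.const_mul α).add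
    ((hasStrictFDerivAt_norm_sq (0 : Plane)).hasFDerivAt.const_mul k)).congr_fderiv ?_
  simp

theorem linPair_innerSL_injective {v : Plane} {α β : ℝ} (hα : α ≠ 0) (hβ : β ≠ 0) (hv : v ≠ 0) :
    Function.Injective (linPair (β • innerSL ℝ v) (α • innerSL ℝ (quarterTurn v))) := by
  apply linPair_injective (d₀ := v) (d₁ := quarterTurn v)
  · simpa [hβ] using hv
  · simp [inner_quarterTurn_self]
  · simpa [hα] using (norm_quarterTurn v).trans_ne (norm_ne_zero_iff.mpr hv)

/-- With `m² = ‖z‖² n` for the equation of `S`, the identity `β² m² + α² n² = ‖z‖² G`, where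
`G 0 ≠ 0`, turns this equation into the one of a cusp, `α² n³ = (G - β² n) m²`. -/
theorem hasOrdinaryCuspAt_of_sq_eq {S : Set Plane} {v : Plane} {α β p k : ℝ} (hα : α ≠ 0)
    (hβ : β ≠ 0) (hv : v ≠ 0)
    (hS : ∀ z, z ∈ S ↔ (α * inner ℝ z (quarterTurn v) + p * ‖z‖ ^ 2) ^ 2
      = ‖z‖ ^ 2 * (β * inner ℝ z v + k * ‖z‖ ^ 2)) :
    HasOrdinaryCuspAt S 0 v := by
  set m : Plane → ℝ := fun z => α * inner ℝ z (quarterTurn v) + p * ‖z‖ ^ 2 with hm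
  set n : Plane → ℝ := fun z => β * inner ℝ z v + k * ‖z‖ ^ 2 with hn
  set G : Plane → ℝ := fun z => α ^ 2 * β ^ 2 * ‖v‖ ^ 2
    + 2 * α * β ^ 2 * p * inner ℝ z (quarterTurn v) + 2 * α ^ 2 * β * k * inner ℝ z v
    + ‖z‖ ^ 2 * (β ^ 2 * p ^ 2 + α ^ 2 * k ^ 2) with hG
  obtain ⟨hmsmooth, hnsmooth, hGsmooth⟩ :
      ContDiff ℝ ∞ m ∧ ContDiff ℝ ∞ n ∧ ContDiff ℝ ∞ G := by
    simp only [hm, hn, hG, norm_sq_eq, inner_eq]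
    exact ⟨by fun_prop, by fun_prop, by fun_prop⟩
  have hm0 : m 0 = 0 := by simp [hm]
  have hn0 : n 0 = 0 := by simp [hn]
  have hG0 : G 0 ≠ 0 := by
    simpa [hG] using ⟨⟨hα, hβ⟩, hv⟩
  have hJv : inner ℝ (quarterTurn v) v = 0 := by
    rw [real_inner_comm, inner_quarterTurn_self]
  refine hasOrdinaryCuspAt_of_eq (Ω := {z | G z ≠ 0}) (W := fun z => (G z - β ^ 2 * n z) / α ^ 2)
    (isOpen_ne_fun hGsmooth.continuous continuous_const) hG0 (by fun_prop) hmsmooth hnsmooth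
    (by simpa [hn0, hα] using hG0) hm0 hn0 (hasFDerivAt_inner_add_norm_sq _ α p)
    (hasFDerivAt_inner_add_norm_sq v β k)
    (linPair_innerSL_injective hα hβ hv) hv (by simp [hJv]) fun z hz => ?_
  have hmn : β ^ 2 * m z ^ 2 + α ^ 2 * n z ^ 2 = ‖z‖ ^ 2 * G z := by
    simp only [hm, hn, hG, norm_sq_eq, inner_eq, quarterTurn_zero, quarterTurn_one]
    ring
  have hcusp : G z * (m z ^ 2 - ‖z‖ ^ 2 * n z)
      = (G z - β ^ 2 * n z) * m z ^ 2 - α ^ 2 * n z ^ 3 := by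
    linear_combination n z * hmn
  rw [hS, ← sub_eq_zero, ← mul_eq_zero_iff_left hz, hcusp, sub_eq_zero, div_mul_eq_mul_div,
    eq_div_iff (pow_ne_zero 2 hα), mul_comm (α ^ 2), eq_comm]

namespace QuadEq

theorem contDiff_invEval (q : QuadEq) : ContDiff ℝ ∞ q.invEval := by
  unfold invEval
  fun_prop

theorem hasFDerivAt_invEval (q : QuadEq) (x : Plane) :
    HasFDerivAt q.invEval
      ((2 * (q.a₁₁ * x 0 + q.a₁₂ * x 1 + q.a₁ * (x 0 ^ 2 + x 1 ^ 2)
          + 2 * x 0 * (q.a₁ * x 0 + q.a₂ * x 1 + q.c * (x 0 ^ 2 + x 1 ^ 2))))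
          • (EuclideanSpace.proj 0 : Plane →L[ℝ] ℝ)
        + (2 * (q.a₁₂ * x 0 + q.a₂₂ * x 1 + q.a₂ * (x 0 ^ 2 + x 1 ^ 2)
          + 2 * x 1 * (q.a₁ * x 0 + q.a₂ * x 1 + q.c * (x 0 ^ 2 + x 1 ^ 2))))
          • (EuclideanSpace.proj 1 : Plane →L[ℝ] ℝ)) x := by
  have h0 := PiLp.hasFDerivAt_apply (𝕜 := ℝ) 2 x 0
  have h1 := PiLp.hasFDerivAt_apply (𝕜 := ℝ) 2 x 1
  have hr := (h0.pow 2).add (h1.pow 2)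
  refine (((((((hr.pow 2).const_mul q.c).add ((hr.const_mul (2 * q.a₁)).mul h0)).add
    ((hr.const_mul (2 * q.a₂)).mul h1)).add ((h0.pow 2).const_mul q.a₁₁)).add
    ((h0.mul h1).const_mul (2 * q.a₁₂))).add ((h1.pow 2).const_mul q.a₂₂)).congr_fderiv ?_
  ext w
  simp only [add_apply, smul_apply, smul_eq_mul, Pi.add_apply, nsmul_eq_mul]
  push_cast
  ring

/-- At a singular point `x`, the vector `(x, ‖x‖²)` is in the kernel of the matrix of the conic. -/
theorem isRegularAt_invZeros {q : QuadEq} (hq : q.det ≠ 0) {x : Plane} (hx : x ∈ q.invZeros)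
    (hx0 : x ≠ 0) : IsRegularAt q.invZeros x := by
  refine isRegularAt_of_hasFDerivAt q.contDiff_invEval (fun z => Iff.rfl) hx
    (q.hasFDerivAt_invEval x) fun hgrad => ?_
  have hr := (sq_add_sq_pos hx0).ne'
  have hval : q.invEval x = 0 := hx
  have hg0 := congrArg (· (!₂[1, 0] : Plane)) hgrad
  have hg1 := congrArg (· (!₂[0, 1] : Plane)) hgrad
  simp only [add_apply, smul_apply, PiLp.proj_apply, Matrix.cons_val_zero, Matrix.cons_val_one,
    Matrix.cons_val_fin_one, smul_eq_mul, mul_one, mul_zero, add_zero, zero_add, zero_apply,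
    mul_eq_zero, OfNat.ofNat_ne_zero, false_or] at hg0 hg1
  rw [invEval] at hval
  have k2 : q.a₁ * x 0 + q.a₂ * x 1 + q.c * (x 0 ^ 2 + x 1 ^ 2) = 0 := by
    apply mul_left_cancel₀ hr
    linear_combination x 0 * hg0 + x 1 * hg1 - hval
  have k0 : q.a₁₁ * x 0 + q.a₁₂ * x 1 + q.a₁ * (x 0 ^ 2 + x 1 ^ 2) = 0 := by
    linear_combination hg0 - 2 * x 0 * k2
  have k1 : q.a₁₂ * x 0 + q.a₂₂ * x 1 + q.a₂ * (x 0 ^ 2 + x 1 ^ 2) = 0 := by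
    linear_combination hg1 - 2 * x 1 * k2
  have hdet : q.det * (x 0 ^ 2 + x 1 ^ 2) = 0 := by
    rw [det]
    linear_combination (q.a₁₂ * q.a₂ - q.a₂₂ * q.a₁) * k0 + (q.a₁₂ * q.a₁ - q.a₁₁ * q.a₂) * k1
      + (q.a₁₁ * q.a₂₂ - q.a₁₂ ^ 2) * k2
  exact mul_ne_zero hq hr hdet

/-- The symmetric bilinear form whose diagonal is `form`. -/
def bilin (q : QuadEq) (v w : Plane) : ℝ :=
  (q.a₁₁ * v 0 + q.a₁₂ * v 1) * w 0 + (q.a₁₂ * v 0 + q.a₂₂ * v 1) * w 1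

theorem bilin_self_smul_add_smul (q : QuadEq) (u v : Plane) (x y : ℝ) :
    q.bilin (x • u + y • v) (x • u + y • v)
      = x ^ 2 * q.bilin u u + 2 * (x * y) * q.bilin u v + y ^ 2 * q.bilin v v := by
  simp only [bilin, PiLp.add_apply, PiLp.smul_apply, smul_eq_mul]
  ring

theorem disc_mul_sq (q : QuadEq) (v w : Plane) :
    (q.a₁₂ ^ 2 - q.a₁₁ * q.a₂₂) * inner ℝ w (quarterTurn v) ^ 2
      = q.bilin v w ^ 2 - q.bilin v v * q.bilin w w := by
  simp only [bilin, inner_eq, quarterTurn_zero, quarterTurn_one]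
  ring

/-- The Gram determinant of the conic in the basis `(p, 1)`, `(v, 0)`, `(w, 0)` of the homogeneous
coordinates. -/
theorem det_mul_sq (q : QuadEq) (p v w : Plane) :
    q.det * inner ℝ w (quarterTurn v) ^ 2
      = q.eval p * (q.bilin v v * q.bilin w w - q.bilin v w ^ 2)
        - q.bilin v v * q.polar p (w 0) (w 1) ^ 2
        + 2 * q.bilin v w * q.polar p (v 0) (v 1) * q.polar p (w 0) (w 1)
        - q.bilin w w * q.polar p (v 0) (v 1) ^ 2 := by
  simp only [bilin, det, eval, polar, inner_eq, quarterTurn_zero, quarterTurn_one, smul_eq_mul]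
  ring

/-- Near the origin, the quadratic form, which is definite, dominates the other terms: by the
Cayley-Hamilton theorem `M² - tr M * M + det M = 0` for its matrix `M`, and so
`tr M * invEval z = ‖M z‖² + ‖z‖² (det M + o(1))`. -/
theorem isIsolatedPointOf_invZeros {q : QuadEq} (h : q.a₁₂ ^ 2 - q.a₁₁ * q.a₂₂ < 0) :
    IsIsolatedPointOf q.invZeros 0 := by
  set τ := q.a₁₁ + q.a₂₂
  set G : Plane → ℝ := fun z => q.a₁₁ * q.a₂₂ - q.a₁₂ ^ 2
    + τ * (2 * (q.a₁ * z 0 + q.a₂ * z 1) + q.c * (z 0 ^ 2 + z 1 ^ 2)) with hG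
  refine ⟨{z | 0 < G z}, isOpen_lt continuous_const (by fun_prop), ?_⟩
  ext z
  constructor
  · rintro ⟨hz, hzero⟩
    by_contra hz0
    have hpos : 0 < (z 0 ^ 2 + z 1 ^ 2) * G z := mul_pos (sq_add_sq_pos hz0) hz
    have hsum : (q.a₁₁ * z 0 + q.a₁₂ * z 1) ^ 2 + (q.a₁₂ * z 0 + q.a₂₂ * z 1) ^ 2
        + (z 0 ^ 2 + z 1 ^ 2) * G z = τ * q.invEval z := by
      rw [invEval]; ring
    rw [show q.invEval z = 0 from hzero, mul_zero] at hsum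
    linarith [sq_nonneg (q.a₁₁ * z 0 + q.a₁₂ * z 1), sq_nonneg (q.a₁₂ * z 0 + q.a₂₂ * z 1)]
  · rintro rfl
    refine ⟨?_, zero_mem_invZeros q⟩
    simp only [hG, PiLp.zero_apply, Set.mem_ofPred_eq]
    linarith

/-- In the coordinates `⟪z, J d₁⟫` and `⟪z, J d₂⟫`, where `J` is the quarter turn, the quadratic
form is a multiple of the product of the coordinates. -/
theorem hasNodeAt_invZeros {q : QuadEq} (hq : q.det ≠ 0) {d₁ d₂ : Plane}
    (hd : inner ℝ d₂ (quarterTurn d₁) ≠ 0) (h₁ : q.bilin d₁ d₁ = 0) (h₂ : q.bilin d₂ d₂ = 0) :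
    HasNodeAt q.invZeros 0 d₁ d₂ := by
  have h₁₂ : q.bilin d₁ d₂ ≠ 0 := by
    intro h₁₂
    refine mul_ne_zero hq (pow_ne_zero 2 hd) ?_
    rw [det_mul_sq q 0, h₁, h₂, h₁₂]
    ring
  have hd' : inner ℝ d₁ (quarterTurn d₂) ≠ 0 := by
    rwa [inner_quarterTurn_comm, neg_ne_zero]
  set ℓ : Plane → Plane →L[ℝ] ℝ := fun d => innerSL ℝ (quarterTurn d)
  have hℓ (d z : Plane) : ℓ d z = inner ℝ z (quarterTurn d) :=
    real_inner_comm z (quarterTurn d)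
  set M : Plane → ℝ := fun z => 2 * (q.a₁ * z 0 + q.a₂ * z 1) + q.c * (z 0 ^ 2 + z 1 ^ 2) with hM
  have hM0 : M 0 = 0 := by simp [hM]
  refine hasNodeAt_of_eq (A := fun z => M z * ‖d₂‖ ^ 2)
    (B := fun z => -q.bilin d₁ d₂ - M z * inner ℝ d₁ d₂) (C := fun z => M z * ‖d₁‖ ^ 2)
    (f' := ℓ d₁) (g' := ℓ d₂) (by fun_prop) (by fun_prop) (by fun_prop) (ℓ d₁).contDiff
    (ℓ d₂).contDiff (by simp [hM0]) (by simpa [hM0] using h₁₂) (by simp [hM0]) (map_zero _)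
    (map_zero _) (ℓ d₁).hasFDerivAt (ℓ d₂).hasFDerivAt ?_ ?_ ?_ ?_ fun z => ?_
  · rw [hℓ, inner_quarterTurn_self]
  · rwa [hℓ]
  · rwa [hℓ]
  · rw [hℓ, inner_quarterTurn_self]
  · have hexpand : inner ℝ d₂ (quarterTurn d₁) ^ 2 * q.invEval z
        = M z * ‖d₂‖ ^ 2 * ℓ d₁ z ^ 2
          + 2 * (-q.bilin d₁ d₂ - M z * inner ℝ d₁ d₂) * (ℓ d₁ z * ℓ d₂ z)
          + M z * ‖d₁‖ ^ 2 * ℓ d₂ z ^ 2 := by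
      simp only [hM, hℓ, invEval, bilin, norm_sq_eq, inner_eq, quarterTurn_zero,
        quarterTurn_one] at h₁ h₂ ⊢
      linear_combination (z 1 * d₂ 0 - z 0 * d₂ 1) ^ 2 * h₁ + (z 1 * d₁ 0 - z 0 * d₁ 1) ^ 2 * h₂
    rw [← hexpand, mul_eq_zero_iff_left (pow_ne_zero 2 hd)]
    rfl

/-- If `v` spans the kernel of the quadratic form, then completing a square brings the equation
to the form of `hasOrdinaryCuspAt_of_sq_eq`. -/
theorem hasOrdinaryCuspAt_invZeros {q : QuadEq} (hq : q.det ≠ 0) {v : Plane} (hv : v ≠ 0)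
    (hker : ∀ w, q.bilin w v = 0) : HasOrdinaryCuspAt q.invZeros 0 v := by
  have h0 : q.a₁₁ * v 0 + q.a₁₂ * v 1 = 0 := by simpa [bilin] using hker !₂[1, 0]
  have h1 : q.a₁₂ * v 0 + q.a₂₂ * v 1 = 0 := by simpa [bilin] using hker !₂[0, 1]
  set τ := q.a₁₁ + q.a₂₂
  set l := q.a₁ * v 0 + q.a₂ * v 1
  set p := -q.a₁ * v 1 + q.a₂ * v 0
  have hv2 := (sq_add_sq_pos hv).ne'
  have hdet : q.det * (v 0 ^ 2 + v 1 ^ 2) = -τ * l ^ 2 := by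
    rw [det]
    linear_combination (q.c * (v 0 * q.a₂₂ - v 1 * q.a₁₂) + (q.a₁ ^ 2 - q.a₂ ^ 2) * v 0
      + 2 * q.a₁ * q.a₂ * v 1) * h0 + (q.c * (v 1 * q.a₁₁ - v 0 * q.a₁₂)
      + (q.a₂ ^ 2 - q.a₁ ^ 2) * v 1 + 2 * q.a₁ * q.a₂ * v 0) * h1
  have hτl := hdet ▸ mul_ne_zero hq hv2
  have hτ : τ ≠ 0 := neg_ne_zero.mp (left_ne_zero_of_mul hτl)
  have hl : l ≠ 0 := pow_ne_zero_iff (two_ne_zero) |>.mp (right_ne_zero_of_mul hτl)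
  refine hasOrdinaryCuspAt_of_sq_eq (α := τ) (β := -2 * l * τ) (p := p)
    (k := p ^ 2 - τ * (v 0 ^ 2 + v 1 ^ 2) * q.c) hτ
    (mul_ne_zero (mul_ne_zero (by norm_num) hl) hτ) hv fun z => ?_
  have hz : τ * (v 0 ^ 2 + v 1 ^ 2) * q.invEval z
      = (τ * inner ℝ z (quarterTurn v) + p * ‖z‖ ^ 2) ^ 2 - ‖z‖ ^ 2 *
        (-2 * l * τ * inner ℝ z v + (p ^ 2 - τ * (v 0 ^ 2 + v 1 ^ 2) * q.c) * ‖z‖ ^ 2) := by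
    simp only [invEval, norm_sq_eq, inner_eq, quarterTurn_zero, quarterTurn_one, τ, l, p]
    linear_combination τ * ((v 0 * (z 0 ^ 2 - z 1 ^ 2) + 2 * v 1 * (z 0 * z 1)) * h0
      + (2 * v 0 * (z 0 * z 1) - v 1 * (z 0 ^ 2 - z 1 ^ 2)) * h1)
  rw [← sub_eq_zero, ← hz, mul_eq_zero_iff_left (mul_ne_zero hτ hv2)]
  rfl

end QuadEq

/-! ### Ellipses, hyperbolas and parabolas -/

namespace IsFrame

variable {u v : Plane}

theorem inner_left (h : IsFrame u v) (p : Plane) (x y : ℝ) :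
    inner ℝ (p + x • u + y • v - p) u = x := by
  rw [add_assoc, add_sub_cancel_left, inner_add_left, real_inner_smul_left, real_inner_smul_left,
    real_inner_self_eq_norm_sq, real_inner_comm, h.1, h.2.2]
  ring

theorem inner_right (h : IsFrame u v) (p : Plane) (x y : ℝ) :
    inner ℝ (p + x • u + y • v - p) v = y := by
  rw [add_assoc, add_sub_cancel_left, inner_add_left, real_inner_smul_left, real_inner_smul_left,
    real_inner_self_eq_norm_sq, h.2.1, h.2.2]
  ring

theorem inner_quarterTurn_sq (h : IsFrame u v) : inner ℝ v (quarterTurn u) ^ 2 = 1 := by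
  have hu := norm_sq_eq u
  have hv := norm_sq_eq v
  have huv := inner_eq u v
  rw [h.1] at hu
  rw [h.2.1] at hv
  rw [h.2.2] at huv
  rw [inner_eq, quarterTurn_zero, quarterTurn_one]
  linear_combination -(v 0 ^ 2 + v 1 ^ 2) * hu - hv + (u 0 * v 0 + u 1 * v 1) * huv

theorem inner_quarterTurn_ne_zero (h : IsFrame u v) : inner ℝ v (quarterTurn u) ≠ 0 := by
  rw [← pow_ne_zero_iff two_ne_zero, h.inner_quarterTurn_sq]
  exact one_ne_zero

theorem det_eq (h : IsFrame u v) (q : QuadEq) (p : Plane) :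
    q.det = q.eval p * (q.bilin u u * q.bilin v v - q.bilin u v ^ 2)
        - q.bilin u u * q.polar p (v 0) (v 1) ^ 2
        + 2 * q.bilin u v * q.polar p (u 0) (u 1) * q.polar p (v 0) (v 1)
        - q.bilin v v * q.polar p (u 0) (u 1) ^ 2 := by
  rw [← q.det_mul_sq p u v, h.inner_quarterTurn_sq, mul_one]

theorem bilin_eq_zero (h : IsFrame u v) {q : QuadEq} (huv : q.bilin u v = 0)
    (hv : q.bilin v v = 0) (w : Plane) : q.bilin w v = 0 := by
  have hcramer : inner ℝ v (quarterTurn u) * q.bilin w v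
      = inner ℝ v (quarterTurn w) * q.bilin u v + inner ℝ w (quarterTurn u) * q.bilin v v := by
    simp only [QuadEq.bilin, inner_eq, quarterTurn_zero, quarterTurn_one]
    ring
  rw [huv, hv, mul_zero, mul_zero, add_zero] at hcramer
  exact (mul_eq_zero.mp hcramer).resolve_left h.inner_quarterTurn_ne_zero

end IsFrame

namespace QuadEq

variable {q : QuadEq}

theorem eval_add_smul_add_smul (q : QuadEq) (p u v : Plane) (x y : ℝ) :
    q.eval (p + x • u + y • v) = q.eval p
      + 2 * (x * q.polar p (u 0) (u 1) + y * q.polar p (v 0) (v 1))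
      + (x ^ 2 * q.bilin u u + 2 * (x * y) * q.bilin u v + y ^ 2 * q.bilin v v) := by
  simp only [eval, polar, bilin, PiLp.add_apply, PiLp.smul_apply, smul_eq_mul]
  ring

theorem isIsolatedPointOf_of_isEllipse (hq : q.det ≠ 0) (h : IsEllipse q.zeros) :
    IsIsolatedPointOf q.invZeros 0 := by
  obtain ⟨p, u, v, a, b, hframe, ha, hb, hzeros⟩ := h
  have hpoint (x y : ℝ) (hxy : x ^ 2 + y ^ 2 = 1) :
      q.eval (p + (a * x) • u + (b * y) • v) = 0 := by
    rw [← mem_zeros, hzeros, Set.mem_ofPred_eq, hframe.inner_left, hframe.inner_right,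
      mul_div_cancel_left₀ _ ha.ne', mul_div_cancel_left₀ _ hb.ne', hxy]
  simp only [eval_add_smul_add_smul] at hpoint
  have hright := hpoint 1 0 (by norm_num)
  have hleft := hpoint (-1) 0 (by norm_num)
  have htop := hpoint 0 1 (by norm_num)
  have hbottom := hpoint 0 (-1) (by norm_num)
  have hother := hpoint (3 / 5) (4 / 5) (by norm_num)
  have hu : q.polar p (u 0) (u 1) = 0 := by
    apply mul_left_cancel₀ ha.ne'
    linear_combination (hright - hleft) / 4
  have hv : q.polar p (v 0) (v 1) = 0 := by
    apply mul_left_cancel₀ hb.ne'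
    linear_combination (htop - hbottom) / 4
  have huu : a ^ 2 * q.bilin u u = -q.eval p := by
    linear_combination (hright + hleft) / 2
  have hvv : b ^ 2 * q.bilin v v = -q.eval p := by
    linear_combination (htop + hbottom) / 2
  have huv : q.bilin u v = 0 := by
    apply mul_left_cancel₀ (mul_pos ha hb).ne'
    linear_combination 25 / 24 * hother - 5 / 4 * a * hu - 5 / 3 * b * hv - 3 / 8 * huu
      - 2 / 3 * hvv
  rw [hframe.det_eq q p, hu, hv, huv] at hq
  have hE : q.eval p ≠ 0 := fun hE => hq (by rw [hE]; ring)
  apply isIsolatedPointOf_invZeros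
  have hdisc := q.disc_mul_sq u v
  rw [hframe.inner_quarterTurn_sq, huv, mul_one] at hdisc
  have hpos : 0 < a ^ 2 * b ^ 2 * (q.bilin u u * q.bilin v v) := by
    rw [mul_mul_mul_comm, huu, hvv]
    exact mul_self_pos.mpr (neg_ne_zero.mpr hE)
  linarith [pos_of_mul_pos_right hpos (by positivity)]

theorem hasNodeAt_of_isHyperbola (hq : q.det ≠ 0) {d₁ d₂ : Plane}
    (h : IsHyperbolaWithAsymptotes q.zeros d₁ d₂) : HasNodeAt q.invZeros 0 d₁ d₂ := by
  obtain ⟨p, u, v, a, b, hframe, ha, hb, hzeros, rfl, rfl⟩ := h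
  have hpoint (x y : ℝ) (hxy : x ^ 2 - y ^ 2 = 1) :
      q.eval (p + (a * x) • u + (b * y) • v) = 0 := by
    rw [← mem_zeros, hzeros, Set.mem_ofPred_eq, hframe.inner_left, hframe.inner_right,
      mul_div_cancel_left₀ _ ha.ne', mul_div_cancel_left₀ _ hb.ne', hxy]
  simp only [eval_add_smul_add_smul] at hpoint
  have hright := hpoint 1 0 (by norm_num)
  have hleft := hpoint (-1) 0 (by norm_num)
  have h₁ := hpoint (5 / 3) (4 / 3) (by norm_num)
  have h₂ := hpoint (5 / 3) (-(4 / 3)) (by norm_num)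
  have h₃ := hpoint (-(5 / 3)) (4 / 3) (by norm_num)
  have hu : q.polar p (u 0) (u 1) = 0 := by
    apply mul_left_cancel₀ ha.ne'
    linear_combination (hright - hleft) / 4
  have huu : a ^ 2 * q.bilin u u = -q.eval p := by
    linear_combination (hright + hleft) / 2
  have huv : q.bilin u v = 0 := by
    apply mul_left_cancel₀ (mul_pos ha hb).ne'
    linear_combination 9 / 80 * (h₁ - h₃) - 3 / 4 * a * hu
  have hvv : b ^ 2 * q.bilin v v = q.eval p := by
    linear_combination 9 / 32 * (h₁ + h₂) - 15 / 8 * a * hu - 25 / 16 * huu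
  have hcross : inner ℝ (a • u - b • v) (quarterTurn (a • u + b • v))
      = -2 * (a * b) * inner ℝ v (quarterTurn u) := by
    simp only [inner_eq, quarterTurn_zero, quarterTurn_one, PiLp.add_apply, PiLp.sub_apply,
      PiLp.smul_apply, smul_eq_mul]
    ring
  apply hasNodeAt_invZeros hq
  · rw [hcross]
    exact mul_ne_zero (mul_ne_zero (by norm_num) (mul_pos ha hb).ne')
      hframe.inner_quarterTurn_ne_zero
  · rw [bilin_self_smul_add_smul]
    linear_combination huu + hvv + 2 * (a * b) * huv
  · rw [sub_eq_add_neg, ← neg_smul, bilin_self_smul_add_smul]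
    linear_combination huu + hvv - 2 * (a * b) * huv

theorem bilin_eq_zero_of_isParabola {v : Plane} (h : IsParabolaWithAxis q.zeros v) (w : Plane) :
    q.bilin w v = 0 := by
  obtain ⟨p, u, k, hframe, hk, hzeros⟩ := h
  have hpoint (s : ℝ) : q.eval (p + s • u + (k * s ^ 2) • v) = 0 := by
    rw [← mem_zeros, hzeros, Set.mem_ofPred_eq, hframe.inner_left, hframe.inner_right]
  simp only [eval_add_smul_add_smul] at hpoint
  have hvv : q.bilin v v = 0 := by
    apply mul_left_cancel₀ (pow_ne_zero 2 hk)
    linear_combination (hpoint 2 + hpoint (-2) - 4 * hpoint 1 - 4 * hpoint (-1) + 6 * hpoint 0) / 24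
  have huv : q.bilin u v = 0 := by
    apply mul_left_cancel₀ hk
    linear_combination (hpoint 2 - hpoint (-2) - 2 * hpoint 1 + 2 * hpoint (-1)) / 24
  exact hframe.bilin_eq_zero huv hvv w

theorem hasOrdinaryCuspAt_of_isParabola (hq : q.det ≠ 0) {v : Plane}
    (h : IsParabolaWithAxis q.zeros v) : HasOrdinaryCuspAt q.invZeros 0 v := by
  obtain ⟨_, u, _, hframe, _⟩ := id h
  exact hasOrdinaryCuspAt_invZeros hq (norm_ne_zero_iff.mp (hframe.2.1 ▸ one_ne_zero))
    (bilin_eq_zero_of_isParabola h)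

theorem dual_c_eq_zero (h : IsParabola q.zeros) : q.dual.c = 0 := by
  obtain ⟨v, h⟩ := h
  obtain ⟨_, u, _, hframe, _⟩ := id h
  have hdisc := q.disc_mul_sq u v
  rw [hframe.inner_quarterTurn_sq, bilin_eq_zero_of_isParabola h, bilin_eq_zero_of_isParabola h]
    at hdisc
  rw [dual]
  linear_combination hdisc

end QuadEq

/-! ### Local branches -/

/-- Near the point `x`, the set `S` is a finite union of branches through `x` with the property
`P`. -/
def IsLocalUnionAt (P : (ℝ → Plane) → Set ℝ → Prop) (S : Set Plane) (x : Plane) : Prop :=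
  ∃ U : Set Plane, IsOpen U ∧ x ∈ U ∧
    ∃ (r : ℕ) (γ : Fin r → ℝ → Plane) (t ε : Fin r → ℝ),
      (∀ i, 0 < ε i ∧ γ i (t i) = x ∧ P (γ i) (Set.Ioo (t i - ε i) (t i + ε i))) ∧
      (⋃ i, γ i '' Set.Ioo (t i - ε i) (t i + ε i)) = U ∩ S

/-- The unit normal of the direction `w`, with the junk value `0` at `w = 0`. -/
def unitNormal (w : Plane) : Plane := ‖w‖⁻¹ • quarterTurn w

theorem norm_unitNormal {w : Plane} (hw : w ≠ 0) : ‖unitNormal w‖ = 1 := by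
  rw [unitNormal, norm_smul, norm_quarterTurn, norm_inv, norm_norm,
    inv_mul_cancel₀ (norm_ne_zero_iff.mpr hw)]

theorem inner_unitNormal (w : Plane) : inner ℝ w (unitNormal w) = 0 := by
  rw [unitNormal, inner_smul_right, inner_quarterTurn_self, mul_zero]

theorem contDiffOn_unitNormal {w : ℝ → Plane} {I : Set ℝ} (hw : ContDiffOn ℝ ∞ w I)
    (h0 : ∀ t ∈ I, w t ≠ 0) : ContDiffOn ℝ ∞ (fun t => unitNormal (w t)) I :=
  ((hw.norm ℝ h0).inv fun t ht => norm_ne_zero_iff.mpr (h0 t ht)).smul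
    (quarterTurn.contDiff.comp_contDiffOn hw)

theorem IsRegularOn.isFrontOn {γ : ℝ → Plane} {I : Set ℝ} (hI : IsOpen I) (h : IsRegularOn γ I) :
    IsFrontOn γ I :=
  ⟨fun t => unitNormal (deriv γ t), ⟨h.1,
    contDiffOn_unitNormal (h.1.deriv_of_isOpen hI (by simp)) h.2,
    fun t ht => ⟨norm_unitNormal (h.2 t ht), inner_unitNormal _⟩⟩, fun t ht => Or.inl (h.2 t ht)⟩

theorem IsLocalUnionAt.isFrontOn {S : Set Plane} {x : Plane} (h : IsLocalUnionAt IsRegularOn S x) :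
    IsLocalUnionAt IsFrontOn S x := by
  obtain ⟨U, hU, hx, r, γ, t, ε, hγ, hunion⟩ := h
  exact ⟨U, hU, hx, r, γ, t, ε,
    fun i => ⟨(hγ i).1, (hγ i).2.1, (hγ i).2.2.isFrontOn isOpen_Ioo⟩, hunion⟩

/-- The unit normal field of `w` is an immersion at the time zero: differentiating
`⟪w, ν⟫ = 0` gives `⟪w', ν⟫ + ⟪w, ν'⟫ = 0`. -/
theorem isFrontOn_of_deriv_eq_smul {γ w : ℝ → Plane} {I : Set ℝ} (hI : IsOpen I)
    (hγ : ContDiffOn ℝ ∞ γ I) (hw : ContDiffOn ℝ ∞ w I) (h0 : ∀ t ∈ I, w t ≠ 0)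
    (hγw : ∀ t ∈ I, deriv γ t = t • w t) {w' : Plane} (hw' : HasDerivAt w w' 0)
    (hind : inner ℝ w' (quarterTurn (w 0)) ≠ 0) : IsFrontOn γ I := by
  have hν := contDiffOn_unitNormal hw h0
  refine ⟨fun t => unitNormal (w t), ⟨hγ, hν, fun t ht => ⟨norm_unitNormal (h0 t ht), ?_⟩⟩,
    fun t ht => ?_⟩
  · rw [hγw t ht, inner_smul_left, inner_unitNormal, mul_zero]
  rcases eq_or_ne t 0 with rfl | ht0
  · refine Or.inr fun hν0 => ?_
    have hν' : HasDerivAt (fun t => unitNormal (w t)) 0 0 := by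
      rw [← hν0]
      exact ((hν.contDiffAt (hI.mem_nhds ht)).differentiableAt (by simp)).hasDerivAt
    have hprod := hw'.inner ℝ hν'
    simp only [inner_unitNormal, inner_zero_right, zero_add] at hprod
    have horth : inner ℝ w' (unitNormal (w 0)) = 0 := hprod.unique (hasDerivAt_const _ _)
    rw [unitNormal, inner_smul_right] at horth
    exact mul_ne_zero (inv_ne_zero (norm_ne_zero_iff.mpr (h0 0 ht))) hind horth
  · left
    rw [hγw t ht]
    exact smul_ne_zero ht0 (h0 t ht)

section LocalModel

variable {φ : OpenPartialHomeomorph Plane Plane} {S T : Set Plane} {x : Plane}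

theorem IsLocalModel.mem_iff (hφ : IsLocalModel φ S x T) {z : Plane} (hz : z ∈ φ.source) :
    z ∈ S ↔ φ z ∈ T := by
  obtain ⟨-, -, -, -, himg⟩ := hφ
  constructor
  · intro hzS
    exact (himg ▸ Set.mem_image_of_mem φ ⟨hz, hzS⟩ : φ z ∈ φ.target ∩ T).2
  · intro hzT
    have himage : φ z ∈ φ '' (φ.source ∩ S) := himg.symm ▸ Set.mem_inter (φ.map_source hz) hzT
    obtain ⟨z', ⟨hz', hz'S⟩, heq⟩ := himage
    rwa [← φ.injOn hz' hz heq]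

theorem IsLocalModel.contDiffAt_symm (hφ : IsLocalModel φ S x T) {y : Plane}
    (hy : y ∈ φ.target) : ContDiffAt ℝ ∞ φ.symm y :=
  hφ.2.2.2.1.contDiffAt (φ.open_target.mem_nhds hy)

theorem IsLocalModel.fderiv_symm_injective (hφ : IsLocalModel φ S x T) {y : Plane}
    (hy : y ∈ φ.target) : Function.Injective (fderiv ℝ φ.symm y) := by
  have hfwd := ((hφ.2.2.1.contDiffAt (φ.open_source.mem_nhds (φ.map_target hy))).differentiableAt
    (by simp)).hasFDerivAt
  have hbwd := ((hφ.contDiffAt_symm hy).differentiableAt (by simp)).hasFDerivAt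
  have hid : HasFDerivAt (φ ∘ φ.symm) (ContinuousLinearMap.id ℝ Plane) y := by
    refine (hasFDerivAt_id y).congr_of_eventuallyEq ?_
    filter_upwards [φ.open_target.mem_nhds hy] with z hz using φ.right_inv hz
  have hcomp := (hfwd.comp y hbwd).unique hid
  exact Function.LeftInverse.injective (g := fderiv ℝ φ (φ.symm y)) fun v => congrArg (· v) hcomp

theorem IsLocalModel.isRegularOn_symm_comp (hφ : IsLocalModel φ S x T) {c : ℝ → Plane}
    (hc : ContDiff ℝ ∞ c) (hc' : ∀ t, deriv c t ≠ 0) {I : Set ℝ} (hI : Set.MapsTo c I φ.target) :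
    IsRegularOn (φ.symm ∘ c) I := by
  refine ⟨hφ.2.2.2.1.comp hc.contDiffOn hI, fun t ht h0 => hc' t ?_⟩
  have hψ := ((hφ.contDiffAt_symm (hI ht)).differentiableAt (by simp)).hasFDerivAt
  rw [(hψ.comp_hasDerivAt t ((hc.differentiable (by simp)) t).hasDerivAt).deriv] at h0
  exact hφ.fderiv_symm_injective (hI ht) (h0.trans (map_zero _).symm)

/-- An open rectangle around the origin. -/
def box (a b : ℝ) : Set Plane := {y | |y 0| < a ∧ |y 1| < b}

theorem isOpen_box (a b : ℝ) : IsOpen (box a b) :=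
  (isOpen_lt (f := fun y : Plane => |y 0|) (by fun_prop) continuous_const).inter
    (isOpen_lt (f := fun y : Plane => |y 1|) (by fun_prop) continuous_const)

theorem exists_box_subset {W : Set Plane} (hW : W ∈ nhds (0 : Plane)) :
    ∃ ε, 0 < ε ∧ ε < 1 ∧ box ε ε ⊆ W := by
  obtain ⟨ρ, hρ, hball⟩ := Metric.mem_nhds_iff.mp hW
  refine ⟨min (ρ / 2) (1 / 2), by positivity, (min_le_right _ _).trans_lt (by norm_num),
    fun y ⟨h0, h1⟩ => hball ?_⟩
  rw [mem_ball_zero_iff]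
  apply lt_of_pow_lt_pow_left₀ 2 hρ.le
  have hy0 := sq_lt_sq' (abs_lt.mp (h0.trans_le (min_le_left _ _))).1
    (abs_lt.mp (h0.trans_le (min_le_left _ _))).2
  have hy1 := sq_lt_sq' (abs_lt.mp (h1.trans_le (min_le_left _ _))).1
    (abs_lt.mp (h1.trans_le (min_le_left _ _))).2
  rw [norm_sq_eq]
  linarith [sq_pos_of_pos hρ]

/-- The curves `c i` parametrize the model set `T` in arbitrarily small boxes. -/
theorem IsLocalModel.isLocalUnionAt (hφ : IsLocalModel φ S x T)
    {P : (ℝ → Plane) → Set ℝ → Prop} {r : ℕ} {c : Fin r → ℝ → Plane} (hc0 : ∀ i, c i 0 = 0)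
    (hc : ∀ ε, 0 < ε → ε < 1 → ∃ a b, 0 < a ∧ a ≤ ε ∧ 0 < b ∧ b ≤ ε ∧
      ⋃ i, c i '' Set.Ioo (-ε) ε = box a b ∩ T)
    (hP : ∀ i, ∀ ε > 0, Set.MapsTo (c i) (Set.Ioo (-ε) ε) φ.target →
      P (φ.symm ∘ c i) (Set.Ioo (-ε) ε)) : IsLocalUnionAt P S x := by
  have htarget : (0 : Plane) ∈ φ.target := hφ.2.1 ▸ φ.map_source hφ.1
  obtain ⟨ε, hε, hε1, hbox⟩ := exists_box_subset (φ.open_target.mem_nhds htarget)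
  obtain ⟨a, b, ha, haε, hb, hbε, hunion⟩ := hc ε hε hε1
  have hsub : box a b ⊆ φ.target :=
    fun y hy => hbox ⟨hy.1.trans_le haε, hy.2.trans_le hbε⟩
  have hmaps (i : Fin r) : Set.MapsTo (c i) (Set.Ioo (-ε) ε) (box a b ∩ T) := fun t ht =>
    hunion ▸ Set.mem_iUnion.mpr ⟨i, t, ht, rfl⟩
  have hx : φ x ∈ box a b := by
    rw [hφ.2.1]
    exact ⟨by simpa using ha, by simpa using hb⟩
  refine ⟨φ.source ∩ φ ⁻¹' box a b, φ.isOpen_inter_preimage (isOpen_box a b), ⟨hφ.1, hx⟩, r,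
    fun i => φ.symm ∘ c i, fun _ => 0, fun _ => ε, fun i => ⟨hε, ?_, ?_⟩, ?_⟩
  · change φ.symm (c i 0) = x
    rw [hc0, ← hφ.2.1, φ.left_inv hφ.1]
  · rw [zero_sub, zero_add]
    exact hP i ε hε fun t ht => hsub (hmaps i ht).1
  · simp only [zero_sub, zero_add, Set.image_comp, ← Set.image_iUnion, hunion]
    ext z
    constructor
    · rintro ⟨y, ⟨hy, hyT⟩, rfl⟩
      have hz := φ.map_target (hsub hy)
      refine ⟨⟨hz, ?_⟩, (hφ.mem_iff hz).mpr ?_⟩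
      · rwa [Set.mem_preimage, φ.right_inv (hsub hy)]
      · rwa [φ.right_inv (hsub hy)]
    · rintro ⟨⟨hz, hzbox⟩, hzS⟩
      exact ⟨φ z, ⟨hzbox, (hφ.mem_iff hz).mp hzS⟩, φ.left_inv hz⟩

end LocalModel

/-- The parametrized coordinate axes. -/
def axis (i : Fin 2) (t : ℝ) : Plane := t • EuclideanSpace.single i 1

theorem contDiff_axis (i : Fin 2) : ContDiff ℝ ∞ (axis i) :=
  contDiff_id.smul contDiff_const

theorem deriv_axis_ne_zero (i : Fin 2) (t : ℝ) : deriv (axis i) t ≠ 0 := by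
  have h : HasDerivAt (axis i) ((1 : ℝ) • EuclideanSpace.single i 1) t :=
    (hasDerivAt_id t).smul_const _
  rw [h.deriv]
  simp

theorem axis_zero_image (ε : ℝ) (hε : 0 < ε) :
    axis 0 '' Set.Ioo (-ε) ε = box ε ε ∩ {y | y 1 = 0} := by
  ext y
  constructor
  · rintro ⟨t, ht, rfl⟩
    simpa [axis, box, hε] using abs_lt.mpr ht
  · rintro ⟨⟨h0, -⟩, h1⟩
    exact ⟨y 0, abs_lt.mp h0, plane_ext (by simp [axis]) (by simpa [axis] using Eq.symm h1)⟩

theorem axis_one_image (ε : ℝ) (hε : 0 < ε) :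
    axis 1 '' Set.Ioo (-ε) ε = box ε ε ∩ {y | y 0 = 0} := by
  ext y
  constructor
  · rintro ⟨t, ht, rfl⟩
    simpa [axis, box, hε] using abs_lt.mpr ht
  · rintro ⟨⟨-, h1⟩, h0⟩
    exact ⟨y 1, abs_lt.mp h1, plane_ext (by simpa [axis] using Eq.symm h0) (by simp [axis])⟩

theorem IsRegularAt.isLocalUnionAt {S : Set Plane} {x : Plane} (h : IsRegularAt S x) :
    IsLocalUnionAt IsRegularOn S x := by
  obtain ⟨φ, hφ⟩ := h
  refine hφ.isLocalUnionAt (c := fun _ : Fin 1 => axis 0) (fun _ => zero_smul ℝ _)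
    (fun ε hε _ => ⟨ε, ε, hε, le_rfl, hε, le_rfl, ?_⟩)
    fun _ ε _ hmaps => hφ.isRegularOn_symm_comp (contDiff_axis 0) (deriv_axis_ne_zero 0) hmaps
  rw [Set.iUnion_const, axis_zero_image ε hε]

theorem HasNodeAt.isLocalUnionAt {S : Set Plane} {x d₁ d₂ : Plane} (h : HasNodeAt S x d₁ d₂) :
    IsLocalUnionAt IsRegularOn S x := by
  obtain ⟨-, -, φ, hφ, -, -⟩ := h
  refine hφ.isLocalUnionAt (c := axis) (fun _ => zero_smul ℝ _)
    (fun ε hε _ => ⟨ε, ε, hε, le_rfl, hε, le_rfl, ?_⟩)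
    fun i ε _ hmaps => hφ.isRegularOn_symm_comp (contDiff_axis i) (deriv_axis_ne_zero i) hmaps
  ext y
  rw [Set.mem_iUnion, Fin.exists_fin_two, axis_zero_image ε hε, axis_one_image ε hε]
  simp only [Set.mem_inter_iff, Set.mem_ofPred_eq, mul_eq_zero, ← and_or_left, or_comm]

/-- The semicubical parabola. -/
def cuspCurve (t : ℝ) : Plane := !₂[t ^ 2, t ^ 3]

theorem hasDerivAt_pair {f₀ f₁ : ℝ → ℝ} {a b t : ℝ} (h₀ : HasDerivAt f₀ a t)
    (h₁ : HasDerivAt f₁ b t) : HasDerivAt (fun t => (!₂[f₀ t, f₁ t] : Plane)) !₂[a, b] t := by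
  rw [hasDerivAt_iff_hasFDerivAt, ← hasFDerivWithinAt_univ, hasFDerivWithinAt_piLp]
  intro i
  fin_cases i
  · exact (h₀.hasFDerivAt.congr_fderiv (by ext; simp)).hasFDerivWithinAt
  · exact (h₁.hasFDerivAt.congr_fderiv (by ext; simp)).hasFDerivWithinAt

theorem hasDerivAt_cuspCurve (t : ℝ) :
    HasDerivAt cuspCurve (t • (!₂[2, 3 * t] : Plane)) t := by
  refine (hasDerivAt_pair (hasDerivAt_pow 2 t) (hasDerivAt_pow 3 t)).congr_deriv ?_
  apply plane_ext <;> norm_num <;> ring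

theorem contDiff_cuspCurve : ContDiff ℝ ∞ cuspCurve :=
  contDiffOn_univ.mp (contDiffOn_pair (contDiff_id.pow 2).contDiffOn (contDiff_id.pow 3).contDiffOn)

theorem cuspCurve_image (ε : ℝ) (hε : 0 < ε) : cuspCurve '' Set.Ioo (-ε) ε
    = box (ε ^ 2) (ε ^ 3) ∩ {y | ∃ t : ℝ, y 0 = t ^ 2 ∧ y 1 = t ^ 3} := by
  ext y
  constructor
  · rintro ⟨t, ht, rfl⟩
    have hpow {n : ℕ} (hn : n ≠ 0) : |t ^ n| < ε ^ n := by
      rw [abs_pow]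
      exact pow_lt_pow_left₀ (abs_lt.mpr ht) (abs_nonneg t) hn
    exact ⟨⟨hpow two_ne_zero, hpow three_ne_zero⟩, t, rfl, rfl⟩
  · rintro ⟨⟨h0, -⟩, t, ht0, ht1⟩
    refine ⟨t, abs_lt.mp ?_, plane_ext ht0.symm ht1.symm⟩
    rw [ht0, abs_pow] at h0
    exact lt_of_pow_lt_pow_left₀ 2 hε.le h0

theorem inner_quarterTurn_ne_zero_of_injective {L : Plane →L[ℝ] Plane} (hL : Function.Injective L)
    {v w : Plane} (h : inner ℝ w (quarterTurn v) ≠ 0) :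
    inner ℝ (L w) (quarterTurn (L v)) ≠ 0 := by
  intro hzero
  have hv : v ≠ 0 := by
    rintro rfl
    exact h (by rw [map_zero, inner_zero_right])
  have hLv : quarterTurn (L v) ≠ 0 := by
    rw [← norm_ne_zero_iff, norm_quarterTurn, norm_ne_zero_iff]
    exact (map_ne_zero_iff L hL).mpr hv
  obtain ⟨t, ht⟩ := exists_eq_smul_quarterTurn hLv hzero
  have hJJ : t • quarterTurn (quarterTurn (L v)) = L (-t • v) := by
    rw [map_smul]
    apply plane_ext <;> simp
  rw [hJJ] at ht
  rw [hL ht, real_inner_smul_left, inner_quarterTurn_self, mul_zero] at h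
  exact h rfl

theorem IsLocalModel.isFrontOn_symm_comp_cuspCurve {φ : OpenPartialHomeomorph Plane Plane}
    {S T : Set Plane} {x : Plane} (hφ : IsLocalModel φ S x T) {I : Set ℝ} (hIo : IsOpen I)
    (h0 : 0 ∈ I) (hI : Set.MapsTo cuspCurve I φ.target) : IsFrontOn (φ.symm ∘ cuspCurve) I := by
  set v : ℝ → Plane := fun t => !₂[2, 3 * t] with hv
  have hvsmooth : ContDiff ℝ ∞ v :=
    contDiffOn_univ.mp
      (contDiffOn_pair contDiffOn_const (contDiff_const.mul contDiff_id).contDiffOn)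
  have hv' : HasDerivAt v !₂[0, 3] 0 := by
    have h := hasDerivAt_pair (hasDerivAt_const (0 : ℝ) (2 : ℝ))
      ((hasDerivAt_id (0 : ℝ)).const_mul 3)
    rwa [mul_one] at h
  have hfderiv : ContDiffOn ℝ ∞ (fderiv ℝ φ.symm) φ.target :=
    hφ.2.2.2.1.fderiv_of_isOpen φ.open_target (by simp)
  have hinj (t : ℝ) (ht : t ∈ I) := hφ.fderiv_symm_injective (hI ht)
  have hw' : HasDerivAt (fun t => fderiv ℝ φ.symm (cuspCurve t) (v t))
      (fderiv ℝ φ.symm (cuspCurve 0) !₂[0, 3]) 0 := by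
    have hcomp := ((hfderiv.contDiffAt (φ.open_target.mem_nhds (hI h0))).differentiableAt
      (by simp)).hasFDerivAt.comp_hasDerivAt (0 : ℝ) (hasDerivAt_cuspCurve 0)
    rw [zero_smul, map_zero] at hcomp
    simpa using hcomp.clm_apply hv'
  refine isFrontOn_of_deriv_eq_smul hIo (hφ.2.2.2.1.comp contDiff_cuspCurve.contDiffOn hI)
    (w := fun t => fderiv ℝ φ.symm (cuspCurve t) (v t))
    ((hfderiv.comp contDiff_cuspCurve.contDiffOn hI).clm_apply hvsmooth.contDiffOn)
    (fun t ht => ?_) (fun t ht => ?_) hw' ?_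
  · refine (map_ne_zero_iff _ (hinj t ht)).mpr fun h => two_ne_zero (α := ℝ) ?_
    exact congrArg (· 0) h
  · have hψ := ((hφ.contDiffAt_symm (hI ht)).differentiableAt (by simp)).hasFDerivAt
    rw [(hψ.comp_hasDerivAt t (hasDerivAt_cuspCurve t)).deriv, map_smul]
  · apply inner_quarterTurn_ne_zero_of_injective (hinj 0 h0)
    simp [hv, inner_eq]

theorem HasOrdinaryCuspAt.isLocalUnionAt {S : Set Plane} {x d : Plane}
    (h : HasOrdinaryCuspAt S x d) : IsLocalUnionAt IsFrontOn S x := by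
  obtain ⟨-, φ, hφ, -⟩ := h
  refine hφ.isLocalUnionAt (c := fun _ : Fin 1 => cuspCurve)
    (fun _ => plane_ext (by simp [cuspCurve]) (by simp [cuspCurve]))
    (fun ε hε hε1 => ⟨ε ^ 2, ε ^ 3, by positivity, pow_le_of_le_one hε.le hε1.le two_ne_zero,
      by positivity, pow_le_of_le_one hε.le hε1.le three_ne_zero, ?_⟩)
    fun _ ε hε hmaps => hφ.isFrontOn_symm_comp_cuspCurve isOpen_Ioo ⟨neg_lt_zero.mpr hε, hε⟩ hmaps
  rw [Set.iUnion_const, cuspCurve_image ε hε]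

/-- The constant curve is a front, with a rotating normal. -/
theorem isFrontOn_const (x : Plane) (I : Set ℝ) : IsFrontOn (fun _ => x) I := by
  have hnorm (t : ℝ) : ‖(!₂[Real.cos t, Real.sin t] : Plane)‖ = 1 := by
    rw [← sq_eq_sq₀ (norm_nonneg _) zero_le_one, norm_sq_eq]
    simp
  refine ⟨fun t => !₂[Real.cos t, Real.sin t], ⟨contDiffOn_const,
    contDiffOn_pair Real.contDiff_cos.contDiffOn Real.contDiff_sin.contDiffOn,
    fun t _ => ⟨hnorm t, by simp⟩⟩, fun t _ => Or.inr ?_⟩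
  rw [(hasDerivAt_pair (Real.hasDerivAt_cos t) (Real.hasDerivAt_sin t)).deriv]
  have hturn : (!₂[-Real.sin t, Real.cos t] : Plane)
      = quarterTurn !₂[Real.cos t, Real.sin t] :=
    plane_ext (by simp) (by simp)
  rw [hturn, ← norm_ne_zero_iff, norm_quarterTurn, hnorm]
  exact one_ne_zero

theorem IsIsolatedPointOf.isLocalUnionAt {S : Set Plane} {x : Plane}
    (h : IsIsolatedPointOf S x) : IsLocalUnionAt IsFrontOn S x := by
  obtain ⟨U, hU, hUS⟩ := h
  have hx : x ∈ U ∩ S := hUS ▸ Set.mem_singleton x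
  refine ⟨U, hU, hx.1, 1, fun _ _ => x, fun _ => 0, fun _ => 1,
    fun _ => ⟨one_pos, rfl, isFrontOn_const x _⟩, ?_⟩
  rw [hUS, Set.iUnion_const, Set.Nonempty.image_const ⟨0, by norm_num⟩]

namespace QuadEq

variable {q : QuadEq}

theorem exists_bilin_eq_zero (h : q.a₁₂ ^ 2 - q.a₁₁ * q.a₂₂ = 0) :
    ∃ v : Plane, v ≠ 0 ∧ ∀ w, q.bilin w v = 0 := by
  by_cases hv : (!₂[-q.a₁₂, q.a₁₁] : Plane) = 0
  · have h₁₂ : -q.a₁₂ = 0 := congrArg (· 0) hv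
    have h₁₁ : q.a₁₁ = 0 := congrArg (· 1) hv
    refine ⟨!₂[1, 0], fun h => one_ne_zero (α := ℝ) (congrArg (· 0) h), fun w => ?_⟩
    simp only [bilin, Matrix.cons_val_zero, Matrix.cons_val_one, Matrix.cons_val_fin_one]
    linear_combination w 0 * h₁₁ - w 1 * h₁₂
  · refine ⟨_, hv, fun w => ?_⟩
    simp only [bilin, Matrix.cons_val_zero, Matrix.cons_val_one, Matrix.cons_val_fin_one]
    linear_combination -w 1 * h

theorem exists_isotropic_pair (h : 0 < q.a₁₂ ^ 2 - q.a₁₁ * q.a₂₂) :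
    ∃ d₁ d₂ : Plane, inner ℝ d₂ (quarterTurn d₁) ≠ 0 ∧ q.bilin d₁ d₁ = 0 ∧ q.bilin d₂ d₂ = 0 := by
  simp only [bilin, inner_eq, quarterTurn_zero, quarterTurn_one]
  by_cases h₁₁ : q.a₁₁ = 0
  · have h₁₂ : q.a₁₂ ≠ 0 := by
      rintro h₁₂
      norm_num [h₁₁, h₁₂] at h
    refine ⟨!₂[1, 0], !₂[-q.a₂₂, 2 * q.a₁₂], ?_, ?_, ?_⟩ <;>
      simp only [Matrix.cons_val_zero, Matrix.cons_val_one, Matrix.cons_val_fin_one, h₁₁]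
    · simpa using h₁₂
    · ring
    · ring
  · obtain ⟨δ, hδ, hsq⟩ : ∃ δ : ℝ, δ ≠ 0 ∧ δ ^ 2 = q.a₁₂ ^ 2 - q.a₁₁ * q.a₂₂ :=
      ⟨√_, (Real.sqrt_pos.mpr h).ne', Real.sq_sqrt h.le⟩
    refine ⟨!₂[-q.a₁₂ + δ, q.a₁₁], !₂[-q.a₁₂ - δ, q.a₁₁], ?_, ?_, ?_⟩ <;>
      simp only [Matrix.cons_val_zero, Matrix.cons_val_one, Matrix.cons_val_fin_one]
    · have hcross : (-q.a₁₂ - δ) * -q.a₁₁ + q.a₁₁ * (-q.a₁₂ + δ) = 2 * q.a₁₁ * δ := by ring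
      rw [hcross]
      exact mul_ne_zero (mul_ne_zero two_ne_zero h₁₁) hδ
    · linear_combination q.a₁₁ * hsq
    · linear_combination q.a₁₁ * hsq

theorem isLocalUnionAt_zero (hq : q.det ≠ 0) : IsLocalUnionAt IsFrontOn q.invZeros 0 := by
  rcases lt_trichotomy (q.a₁₂ ^ 2 - q.a₁₁ * q.a₂₂) 0 with hneg | hzero | hpos
  · exact (isIsolatedPointOf_invZeros hneg).isLocalUnionAt
  · obtain ⟨v, hv, hker⟩ := exists_bilin_eq_zero hzero
    exact (hasOrdinaryCuspAt_invZeros hq hv hker).isLocalUnionAt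
  · obtain ⟨d₁, d₂, hd, h₁, h₂⟩ := exists_isotropic_pair hpos
    exact (hasNodeAt_invZeros hq hd h₁ h₂).isLocalUnionAt.isFrontOn

theorem isFrontSet_invZeros (hq : q.det ≠ 0) : IsFrontSet q.invZeros := by
  intro x hx
  rcases eq_or_ne x 0 with rfl | hx0
  · exact isLocalUnionAt_zero hq
  · exact (isRegularAt_invZeros hq hx hx0).isLocalUnionAt.isFrontOn

end QuadEq

end PlaneCurve

end

theorem theorem3p7 (Γ : Set Plane) (q : QuadEq)
    (hΓ : IsAlgebraicCurve Γ)
    (hdense : Γ \ {0} ⊆ closure (noSilhouettePart Γ))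
    (hnocircle : ∀ (p : Plane) (r : ℝ), 0 < r → (0 : Plane) ∈ Metric.sphere p r →
      ¬ Metric.sphere p r ⊆ Γ)
    (hline : ¬ IsLine Γ)
    (hcircle : ∀ (p : Plane) (r : ℝ), 0 < r → Γ ≠ Metric.sphere p r)
    (hC : IsIrreducibleQuadraticCurve q.zeros)
    (hprim : closure (primitiveLocus Γ) = q.zeros) :
    ((HasDegree Γ 3 ∨ HasDegree Γ 4) ∧
      IsFrontSet Γ ∧
      IsIrreducibleQuadraticCurve (curveInversion Γ) ∧
      curveInversion Γ \ {0} = puncturedInversion Γ ∧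
      Γ = {x : Plane |
        (q.a₁₂ ^ 2 - q.a₁₁ * q.a₂₂) * (x 0 ^ 2 + x 1 ^ 2) ^ 2
          + 2 * (q.a₁₂ * q.a₂ - q.a₁ * q.a₂₂) * (x 0 ^ 2 + x 1 ^ 2) * x 0
          + 2 * (q.a₁ * q.a₁₂ - q.a₂ * q.a₁₁) * (x 0 ^ 2 + x 1 ^ 2) * x 1
          + (q.a₂ ^ 2 - q.a₂₂ * q.c) * x 0 ^ 2
          + 2 * (q.a₁₂ * q.c - q.a₁ * q.a₂) * (x 0 * x 1)
          + (q.a₁ ^ 2 - q.a₁₁ * q.c) * x 1 ^ 2 = 0} ∧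
      (IsParabola q.zeros → HasDegree Γ 3)) ∧
    (IsEllipse (curveInversion Γ) →
      IsIsolatedPointOf Γ 0 ∧ ∀ x ∈ Γ, x ≠ 0 → IsRegularAt Γ x) ∧
    (∀ d₁ d₂ : Plane, IsHyperbolaWithAsymptotes (curveInversion Γ) d₁ d₂ →
      IsRegularlyParametrized Γ ∧ HasNodeAt Γ 0 d₁ d₂ ∧
        ∀ x ∈ Γ, x ≠ 0 → IsRegularAt Γ x) ∧
    (∀ v : Plane, IsParabolaWithAxis (curveInversion Γ) v →
      HasOrdinaryCuspAt Γ 0 v ∧ ∀ x ∈ Γ, x ≠ 0 → IsRegularAt Γ x) := by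
  have hne : (noSilhouettePart Γ).Nonempty := by
    rw [nonempty_noSilhouettePart_iff, ← closure_nonempty_iff, hprim]
    exact hC.2.1.nonempty
  have hsub : primitiveLocus Γ ⊆ q.zeros := hprim ▸ subset_closure
  have hinf := zeros_dual_infinite hΓ hnocircle hsub hne
  have hq := QuadEq.det_ne_zero hC
  have hD := QuadEq.det_dual_ne_zero hq
  have hreg : ∀ x ∈ q.dual.invZeros, x ≠ 0 → IsRegularAt q.dual.invZeros x :=
    fun x hx hx0 => QuadEq.isRegularAt_invZeros hD hx hx0
  rw [eq_invZeros_dual hΓ hdense hnocircle hline hcircle hq hsub hne,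
    QuadEq.curveInversion_invZeros hD]
  obtain ⟨hdeg, hdeg3⟩ := QuadEq.hasDegree_invZeros hD hinf
  refine ⟨⟨hdeg, QuadEq.isFrontSet_invZeros hD, QuadEq.isIrreducibleQuadraticCurve hD hinf,
      (QuadEq.puncturedInversion_invZeros _).symm, rfl,
      fun h => hdeg3 (QuadEq.dual_c_eq_zero h)⟩,
    fun h => ⟨QuadEq.isIsolatedPointOf_of_isEllipse hD h, hreg⟩, fun d₁ d₂ h => ?_,
    fun v h => ⟨QuadEq.hasOrdinaryCuspAt_of_isParabola hD h, hreg⟩⟩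
  have hnode := QuadEq.hasNodeAt_of_isHyperbola hD h
  refine ⟨fun x hx => ?_, hnode, hreg⟩
  rcases eq_or_ne x 0 with rfl | hx0
  · exact hnode.isLocalUnionAt
  · exact (hreg x hx hx0).isLocalUnionAt
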